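/- Let $n\ge 1$ and $m\ge 0$ be integers, $\alpha>0$ and $0<q<p<\infty$. Write $\langle z,w\rangle=\sum_j z_j\overline{w_j}$ and $|z|=\sqrt{\langle z,z\rangle}$ on $\mathbb{C}^n$, and let $dV$ be Lebesgue measure. For $0<s<\infty$ the Fock--Sobolev space $\mathcal{F}^s_{(m,\alpha)}$ consists of the entire functions $f$ on $\mathbb{C}^n$ with $$\|f\|_{(s,m)}=\Big(C_{(s,m,n)}\int_{\mathbb{C}^n}|z|^{ms}|f(z)|^s e^{-\frac{\alpha s}{2}|z|^2}\,dV(z)\Big)^{1/s}<\infty,\qquad C_{(s,m,n)}=\Big(\frac{\alpha s}{2}\Big)^{\frac{ms}{2}+n}\frac{\Gamma(n)}{\pi^n\,\Gamma(\frac{ms}{2}+n)}.$$ For entire $u:\mathbb{C}^n\to\mathbb{C}$ and entire $\psi:\mathbb{C}^n\to\mathbb{C}^n$ let $uC_\psi f=u\cdot(f\circ\psi)$ and, with $k_w(z)=e^{\alpha\langle z,w\rangle-\alpha|w|^2/2}$, let $$B_{(m,\psi)}(|u|^q)(w)=\int_{\mathbb{C}^n}\frac{|k_w(\psi(z))|^q}{(1+|\psi(z)|)^{mq}}\,|u(z)|^q|z|^{mq}e^{-\frac{\alpha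 q}{2}|z|^2}\,dV(z)\in[0,\infty].$$ Theorem. For every pair $(u,\psi)$ of entire functions as above the following are equivalent: 1. $uC_\psi:\mathcal{F}^p_{(m,\alpha)}\to\mathcal{F}^q_{(m,\alpha)}$ is bounded, that is, it maps $\mathcal{F}^p_{(m,\alpha)}$ into $\mathcal{F}^q_{(m,\alpha)}$ and $\|uC_\psi f\|_{(q,m)}\le C\|f\|_{(p,m)}$ for some finite $C$ and all $f\in\mathcal{F}^p_{(m,\alpha)}$; 2. $uC_\psi:\mathcal{F}^p_{(m,\alpha)}\to\mathcal{F}^q_{(m,\alpha)}$ is compact, that is, it maps $\mathcal{F}^p_{(m,\alpha)}$ into $\mathcal{F}^q_{(m,\alpha)}$ and the image of every bounded sequence of $\mathcal{F}^p_{(m,\alpha)}$ has a subsequence converging in $\mathcal{F}^q_{(m,\alpha)}$; 3. $B_{(m,\psi)}(|u|^q)\in L^{p/(p-q)}(\mathbb{C}^n,dV)$. Moreover, there are constants $c,C>0$ depending only on $n,m,\alpha,p,q$ such that, for every such pair $(u,\psi)$ for which $uC_\psi$ is bounded, the operator norm $\|uC_\psi\|=\sup\{\|uC_\psi f\|_{(q,m)}:\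 f\in\mathcal{F}^p_{(m,\alpha)},\ \|f\|_{(p,m)}\le 1\}$ satisfies $$c\,\|B_{(m,\psi)}(|u|^q)\|_{L^{p/(p-q)}}^{1/q}\le\|uC_\psi\|\le C\,\|B_{(m,\psi)}(|u|^q)\|_{L^{p/(p-q)}}^{1/q}.$$ -/

import Mathlib

open MeasureTheory Filter Topology
open scoped ENNReal NNReal

noncomputable section

namespace FockSobolev

/-- Complex Euclidean space `ℂⁿ` with its Hermitian norm; `volume` is Lebesgue measure. -/
abbrev Cn (n : ℕ) : Type := EuclideanSpace ℂ (Fin n)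

/-- The normalizing constant `(αp/2)^{mp/2+n} Γ(n) / (πⁿ Γ(mp/2+n))`, for which the constant
function `1` has norm one. -/
def normConst (n m : ℕ) (α p : ℝ) : ℝ :=
  (α * p / 2) ^ (m * p / 2 + n : ℝ) * Real.Gamma n /
    (Real.pi ^ n * Real.Gamma (m * p / 2 + n))

/-- The Fock--Sobolev (quasi-)norm of order `m`,
`(C ∫ |z|^{mp} |f(z)|^p e^{-αp|z|²/2} dV(z))^{1/p}`, with value `∞` allowed. -/
def fsNorm (n m : ℕ) (α p : ℝ) (f : Cn n → ℂ) : ℝ≥0∞ :=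
  (ENNReal.ofReal (normConst n m α p) *
    ∫⁻ z : Cn n, ENNReal.ofReal
      (‖z‖ ^ (m * p : ℝ) * ‖f z‖ ^ p * Real.exp (-(α * p / 2) * ‖z‖ ^ 2))) ^ (1 / p)

/-- The Fock--Sobolev space `F^p_{(m,α)}`: entire functions of finite norm. -/
def fsSpace (n m : ℕ) (α p : ℝ) : Set (Cn n → ℂ) :=
  {f | Differentiable ℂ f ∧ fsNorm n m α p f < ∞}

/-- The weighted composition operator `uC_ψ f = u · (f ∘ ψ)`. -/
def wComp {n : ℕ} (u : Cn n → ℂ) (ψ : Cn n → Cn n) (f : Cn n → ℂ) : Cn n → ℂ :=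
  fun z => u z * f (ψ z)

/-- `uC_ψ` maps `F^p_{(m,α)}` into `F^q_{(m,α)}` and is bounded. -/
def IsBoundedOp (n m : ℕ) (α p q : ℝ) (u : Cn n → ℂ) (ψ : Cn n → Cn n) : Prop :=
  (∀ f ∈ fsSpace n m α p, wComp u ψ f ∈ fsSpace n m α q) ∧
    ∃ C : ℝ≥0, ∀ f ∈ fsSpace n m α p,
      fsNorm n m α q (wComp u ψ f) ≤ C * fsNorm n m α p f

/-- `uC_ψ` maps `F^p_{(m,α)}` into `F^q_{(m,α)}` and is compact: the image of every bounded
sequence has a subsequence that converges in `F^q_{(m,α)}`. As the topology of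
`F^q_{(m,α)}` is metrizable (by `‖f - g‖^{min(1,q)}`), this says that images of bounded sets are
relatively compact. -/
def IsCompactOp (n m : ℕ) (α p q : ℝ) (u : Cn n → ℂ) (ψ : Cn n → Cn n) : Prop :=
  (∀ f ∈ fsSpace n m α p, wComp u ψ f ∈ fsSpace n m α q) ∧
    ∀ f : ℕ → Cn n → ℂ, (∀ j, f j ∈ fsSpace n m α p) →
      (∃ R : ℝ≥0, ∀ j, fsNorm n m α p (f j) ≤ R) →
      ∃ φ : ℕ → ℕ, StrictMono φ ∧ ∃ g ∈ fsSpace n m α q,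
        Tendsto (fun j => fsNorm n m α q (wComp u ψ (f (φ j)) - g)) atTop (𝓝 0)

/-- The operator norm of `uC_ψ : F^p_{(m,α)} → F^q_{(m,α)}`: the supremum of `‖uC_ψ f‖` over
the unit ball. -/
def opNorm (n m : ℕ) (α p q : ℝ) (u : Cn n → ℂ) (ψ : Cn n → Cn n) : ℝ≥0∞ :=
  ⨆ f ∈ {f | f ∈ fsSpace n m α p ∧ fsNorm n m α p f ≤ 1}, fsNorm n m α q (wComp u ψ f)

/-- `k_w(z) = e^{α⟨z,w⟩ - α|w|²/2}`, where `⟨z,w⟩ = ∑ z_j conj(w_j)`; Mathlib's `inner` is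
conjugate-linear in its first argument. -/
def kern {n : ℕ} (α : ℝ) (w z : Cn n) : ℂ :=
  Complex.exp (α * inner ℂ w z - α * (‖w‖ : ℂ) ^ 2 / 2)

/-- The Berezin type transform
`B_{(m,ψ)}(|u|^q)(w) = ∫ |k_w(ψ(z))|^q (1+|ψ(z)|)^{-mq} |u(z)|^q |z|^{qm} e^{-αq|z|²/2} dV(z)`,
with value `∞` allowed. -/
def berezin (n m : ℕ) (α q : ℝ) (u : Cn n → ℂ) (ψ : Cn n → Cn n) (w : Cn n) : ℝ≥0∞ :=
  ∫⁻ z : Cn n, ENNReal.ofReal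
    (‖kern α w (ψ z)‖ ^ q / (1 + ‖ψ z‖) ^ (m * q : ℝ) * ‖u z‖ ^ q * ‖z‖ ^ (q * m : ℝ) *
      Real.exp (-(α * q / 2) * ‖z‖ ^ 2))

end FockSobolev

end

noncomputable section

namespace FockSobolev

/-! Let μ be the push-forward under ψ of `pullDens` times Lebesgue measure. Up to a constant, ‖uC_ψ
f‖^q is the integral of `wt f`^q against μ (`fsDens_wComp`), and the Berezin type transform B is the
Gaussian average of μ (`berezin_eq`). The theorem is thus a Carleson embedding theorem for μ in the
range q < p.

Upper bound: `wt f`^q is dominated by its own Gaussian average (`exists_wt_rpow_le`). Tonelli moves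
the Gaussian onto μ, so ‖uC_ψ f‖^q is at most a constant times ∫ `wt f`^q B, and Hölder with
exponents p/q and p/(p-q) finishes. This uses that the weights (1+|z|)^m and |z|^m give equivalent
norms on entire functions (`exists_lintegral_wt_rpow_le`).

Compactness: a bounded sequence has a pointwise convergent subsequence with entire limit (Montel).
In ∫ `wt h_j`^q B, where h_j is the difference from the limit, the part far out is uniformly small
because B has small tails in L^{p/(p-q)}, and the part on a ball tends to 0 by dominated
convergence. Compactness gives back boundedness by scaling.

Lower bound, after Luecking: test on combinations of normalized kernels at lattice points. Averaging
over all sub-sums plays the role of random signs. Only one lattice cell matters at each point, so it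
suffices that the average controls each single term (`card_mul_norm_rpow_le_sum_powerset`), and
Khinchine's inequality is not needed. This bounds ∑ a_k^q μ(cell_k) by ‖a‖_p^q; duality puts the
cell masses in ℓ^{p/(p-q)}, and B is dominated by their Gaussian synthesis
(`exists_lintegral_tsum_gauss_rpow_le`). -/

/-! ### Sub-mean value inequalities. -/

/-- The sub-mean value property of `|f|^q`, for every `q > 0`, of an entire function. -/
theorem norm_rpow_le_circleAverage {f : ℂ → ℂ} (hf : Differentiable ℂ f) {q : ℝ} (hq : 0 < q) :
    ‖f 0‖ ^ q ≤ Real.circleAverage (fun z => ‖f z‖ ^ q) 0 1 := by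
  by_cases h0 : f 0 = 0
  · rw [h0, norm_zero, Real.zero_rpow hq.ne']
    exact Real.circleAverage_nonneg_of_nonneg fun x _ => by positivity
  have han : AnalyticOnNhd ℂ f Set.univ := fun z _ => hf.analyticAt z
  have hanB : AnalyticOnNhd ℂ f (Metric.closedBall 0 |1|) := han.mono (Set.subset_univ _)
  -- Jensen's formula: the zeros in the disc contribute nonnegative terms, which gives the sub-mean
  -- value property of log|f|.
  have hjen := hanB.circleAverage_log_norm one_ne_zero h0
  have hlog : Real.log ‖f 0‖ ≤ Real.circleAverage (fun z => Real.log ‖f z‖) 0 1 := by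
    rw [hjen]
    refine le_add_of_nonneg_left (finsum_nonneg fun u => ?_)
    by_cases hu : u ∈ Metric.closedBall (0 : ℂ) |1|
    · refine mul_nonneg
        (mod_cast MeromorphicOn.AnalyticOnNhd.divisor_nonneg hanB u) ?_
      rcases eq_or_ne u 0 with rfl | hu0
      · simp
      · refine Real.log_nonneg ?_
        rw [one_mul, zero_sub, norm_neg]
        have : ‖u‖ ≤ 1 := by simpa using hu
        exact (one_le_inv₀ (norm_pos_iff.2 hu0)).2 this
    · rw [Function.locallyFinsuppWithin.apply_eq_zero_of_notMem _ hu]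
      simp
  have hpos : 0 < ‖f 0‖ := norm_pos_iff.2 h0
  have hci : CircleIntegrable (fun z => Real.log ‖f z‖) 0 1 :=
    MeromorphicOn.circleIntegrable_log_norm fun z _ => (hf.analyticAt z).meromorphicAt
  have hcont : Continuous fun z => ‖f z‖ ^ q :=
    hf.continuous.norm.rpow_const fun _ => Or.inr hq.le
  -- `g` is the tangent line of the convex function t ↦ e^{qt} at t = log|f 0|, evaluated at log|f
  -- z|.
  set g : ℂ → ℝ := fun z => ‖f 0‖ ^ q * (1 + q * (Real.log ‖f z‖ - Real.log ‖f 0‖)) with hg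
  have hne : {z | f z ≠ 0} ∈ codiscreteWithin (Metric.sphere (0 : ℂ) |1|) :=
    codiscreteWithin_mono (Set.subset_univ _) (han.preimage_zero_mem_codiscrete h0)
  -- Since `Real.log 0 = 0`, `g` may exceed |f|^q at zeros of f. The minimum is below |f|^q
  -- everywhere and differs from `g` only on a negligible set.
  have hae : (fun z => min (g z) (‖f z‖ ^ q)) =ᶠ[codiscreteWithin (Metric.sphere (0 : ℂ) |1|)] g := by
    filter_upwards [hne] with z hz
    refine min_eq_left ?_
    have hzpos : 0 < ‖f z‖ := norm_pos_iff.2 hz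
    have h1 : ‖f z‖ ^ q = ‖f 0‖ ^ q * Real.exp (q * (Real.log ‖f z‖ - Real.log ‖f 0‖)) := by
      rw [Real.rpow_def_of_pos hzpos, Real.rpow_def_of_pos hpos, ← Real.exp_add]
      ring_nf
    rw [h1]
    have := Real.add_one_le_exp (q * (Real.log ‖f z‖ - Real.log ‖f 0‖))
    exact mul_le_mul_of_nonneg_left (by linarith) (by positivity)
  have hgi : CircleIntegrable g 0 1 := by
    have h2 := (((hci.sub (circleIntegrable_const (Real.log ‖f 0‖) 0 1)).const_fun_smul (a := q)).add
      (circleIntegrable_const 1 0 1)).const_fun_smul (a := ‖f 0‖ ^ q)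
    refine h2.congr_codiscreteWithin ?_
    filter_upwards with z
    simp [hg, add_comm]
  have hgavg : Real.circleAverage g 0 1
      = ‖f 0‖ ^ q * (1 + q * (Real.circleAverage (fun z => Real.log ‖f z‖) 0 1
        - Real.log ‖f 0‖)) := by
    have e : g = (‖f 0‖ ^ q) • ((fun _ => (1 : ℝ)) + q • ((fun z => Real.log ‖f z‖)
      - fun _ => Real.log ‖f 0‖)) := by
      funext z; simp [hg]
    rw [e, Real.circleAverage_smul, Real.circleAverage_add (circleIntegrable_const _ _ _)
      ((hci.sub (circleIntegrable_const _ _ _)).const_smul), Real.circleAverage_smul,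
      Real.circleAverage_sub hci (circleIntegrable_const _ _ _), Real.circleAverage_const,
      Real.circleAverage_const]
    simp
  calc ‖f 0‖ ^ q ≤ Real.circleAverage g 0 1 := by
        rw [hgavg]
        refine le_mul_of_one_le_right (by positivity) ?_
        have := mul_nonneg hq.le (sub_nonneg.2 hlog)
        linarith
    _ = Real.circleAverage (fun z => min (g z) (‖f z‖ ^ q)) 0 1 :=
        (Real.circleAverage_congr_codiscreteWithin hae one_ne_zero).symm
    _ ≤ _ := by
        refine Real.circleAverage_mono ?_ ?_ fun x _ => min_le_right _ _
        · exact hgi.congr_codiscreteWithin hae.symm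
        · exact hcont.continuousOn.circleIntegrable zero_le_one

theorem ofReal_norm_rpow_le_lintegral_circle {f : ℂ → ℂ} (hf : Differentiable ℂ f) {q : ℝ}
    (hq : 0 < q) :
    ENNReal.ofReal (2 * Real.pi) * ENNReal.ofReal (‖f 0‖ ^ q)
      ≤ ∫⁻ θ in Set.Ioc 0 (2 * Real.pi), ENNReal.ofReal (‖f (circleMap 0 1 θ)‖ ^ q) := by
  have hcont : Continuous fun θ : ℝ => ‖f (circleMap 0 1 θ)‖ ^ q :=
    (hf.continuous.comp (continuous_circleMap 0 1)).norm.rpow_const fun _ => Or.inr hq.le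
  have h := norm_rpow_le_circleAverage hf hq
  rw [Real.circleAverage_def, smul_eq_mul, ← div_eq_inv_mul, le_div_iff₀ Real.two_pi_pos,
    intervalIntegral.integral_of_le Real.two_pi_pos.le] at h
  rw [← ENNReal.ofReal_mul Real.two_pi_pos.le, ← ofReal_integral_eq_lintegral_ofReal
    ((intervalIntegrable_iff_integrableOn_Ioc_of_le Real.two_pi_pos.le).1
      (hcont.intervalIntegrable _ _)) (ae_of_all _ fun θ => by positivity)]
  refine ENNReal.ofReal_le_ofReal ?_
  rw [mul_comm]
  exact h

theorem lintegral_comp_smul_of_norm_eq_one {n : ℕ} {c : ℂ} (hc : ‖c‖ = 1) {F : Cn n → ℝ≥0∞}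
    (hF : Measurable F) : ∫⁻ v, F (c • v) = ∫⁻ v, F v := by
  have hc0 : c ≠ 0 := norm_ne_zero_iff.1 (by rw [hc]; exact one_ne_zero)
  let e : Cn n ≃ₗᵢ[ℝ] Cn n :=
    ⟨(LinearEquiv.smulOfNeZero ℂ (Cn n) c hc0).restrictScalars ℝ, fun v => by
      change ‖c • v‖ = ‖v‖
      rw [norm_smul, hc, one_mul]⟩
  exact e.measurePreserving.lintegral_comp hF

/-- The sub-mean value property of `|g|^q`, for an entire function `g` on `ℂⁿ`, with respect to
a circular weight `G`. -/
theorem norm_rpow_mul_lintegral_le {n : ℕ} {g : Cn n → ℂ} (hg : Differentiable ℂ g) {q : ℝ}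
    (hq : 0 < q) (z : Cn n) {G : Cn n → ℝ≥0∞} (hG : Measurable G)
    (hrot : ∀ (c : ℂ) (v : Cn n), ‖c‖ = 1 → G (c • v) = G v) :
    ENNReal.ofReal (‖g z‖ ^ q) * ∫⁻ v, G v ≤ ∫⁻ v, ENNReal.ofReal (‖g (z + v)‖ ^ q) * G v := by
  have hpi : ENNReal.ofReal (2 * Real.pi) ≠ 0 := by simp [Real.pi_pos]
  have hgm : Measurable fun v => ENNReal.ofReal (‖g (z + v)‖ ^ q) :=
    ((hg.continuous.comp (continuous_const.add continuous_id)).norm.rpow_const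
      fun _ => Or.inr hq.le).measurable.ennreal_ofReal
  have hmeas2 : Measurable fun x : Cn n × ℝ =>
      ENNReal.ofReal (‖g (z + circleMap 0 1 x.2 • x.1)‖ ^ q) := by
    refine Measurable.ennreal_ofReal (Continuous.measurable ?_)
    refine (hg.continuous.comp ?_).norm.rpow_const fun _ => Or.inr hq.le
    exact continuous_const.add (((continuous_circleMap 0 1).comp continuous_snd).smul
      continuous_fst)
  -- The one-variable inequality is applied on each complex line t ↦ z + tv. After Tonelli,
  -- rotations preserve both volume and `G`, so the integral in θ only contributes 2π.
  rw [← ENNReal.mul_le_mul_iff_right hpi ENNReal.ofReal_ne_top]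
  calc ENNReal.ofReal (2 * Real.pi) * (ENNReal.ofReal (‖g z‖ ^ q) * ∫⁻ v, G v)
      = ∫⁻ v, (ENNReal.ofReal (2 * Real.pi) * ENNReal.ofReal (‖g z‖ ^ q)) * G v := by
        rw [lintegral_const_mul _ hG, mul_assoc]
    _ ≤ ∫⁻ v, (∫⁻ θ in Set.Ioc 0 (2 * Real.pi),
          ENNReal.ofReal (‖g (z + circleMap 0 1 θ • v)‖ ^ q)) * G v := by
        refine lintegral_mono fun v => ?_
        have hd : Differentiable ℂ fun t : ℂ => g (z + t • v) :=
          hg.comp ((differentiable_const z).add (differentiable_id.smul_const v))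
        have := ofReal_norm_rpow_le_lintegral_circle hd hq
        simp only [zero_smul, add_zero] at this
        exact mul_le_mul_left this _
    _ = ∫⁻ v, ∫⁻ θ in Set.Ioc 0 (2 * Real.pi),
          ENNReal.ofReal (‖g (z + circleMap 0 1 θ • v)‖ ^ q) * G v := by
        refine lintegral_congr fun v => ?_
        have hm : Measurable fun θ : ℝ =>
            ENNReal.ofReal (‖g (z + circleMap 0 1 θ • v)‖ ^ q) := by
          refine Measurable.ennreal_ofReal (Continuous.measurable ?_)
          refine (hg.continuous.comp ?_).norm.rpow_const fun _ => Or.inr hq.le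
          exact continuous_const.add ((continuous_circleMap 0 1).smul continuous_const)
        exact (lintegral_mul_const _ hm).symm
    _ = ∫⁻ θ in Set.Ioc 0 (2 * Real.pi), ∫⁻ v,
          ENNReal.ofReal (‖g (z + circleMap 0 1 θ • v)‖ ^ q) * G v :=
        lintegral_lintegral_swap (hmeas2.mul (hG.comp measurable_fst)).aemeasurable
    _ = ∫⁻ _ in Set.Ioc 0 (2 * Real.pi), ∫⁻ v, ENNReal.ofReal (‖g (z + v)‖ ^ q) * G v := by
        refine lintegral_congr fun θ => ?_
        have hc : ‖circleMap 0 1 θ‖ = 1 := by simp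
        have he := lintegral_comp_smul_of_norm_eq_one hc (hgm.mul hG)
        simpa only [Pi.mul_apply, hrot _ _ hc] using he
    _ = _ := by
        rw [lintegral_const, Measure.restrict_apply_univ, Real.volume_Ioc, sub_zero, mul_comm]

/-! ### The weighted modulus and equivalent weights. -/

/-- The weighted modulus `(1+|z|)^m |f(z)| e^{-α|z|²/2}`. -/
def wt {n : ℕ} (m : ℕ) (α : ℝ) (f : Cn n → ℂ) (z : Cn n) : ℝ :=
  (1 + ‖z‖) ^ m * ‖f z‖ * Real.exp (-(α / 2) * ‖z‖ ^ 2)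

theorem wt_nonneg {n : ℕ} (m : ℕ) (α : ℝ) (f : Cn n → ℂ) (z : Cn n) : 0 ≤ wt m α f z := by
  unfold wt; positivity

theorem continuous_wt {n : ℕ} (m : ℕ) (α : ℝ) {f : Cn n → ℂ} (hf : Continuous f) :
    Continuous (wt m α f) := by
  unfold wt; fun_prop

theorem wt_rpow {n : ℕ} (m : ℕ) (α p : ℝ) (f : Cn n → ℂ) (z : Cn n) :
    wt m α f z ^ p
      = ((1 + ‖z‖) ^ m) ^ p * ‖f z‖ ^ p * Real.exp (-(α * p / 2) * ‖z‖ ^ 2) := by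
  unfold wt
  rw [Real.mul_rpow (by positivity) (by positivity), Real.mul_rpow (by positivity) (by positivity),
    ← Real.exp_mul]
  ring_nf

theorem measurable_wt_rpow {n : ℕ} (m : ℕ) (α p : ℝ) {f : Cn n → ℂ} (hf : Continuous f) :
    Measurable fun z => ENNReal.ofReal (wt m α f z ^ p) :=
  ((continuous_wt m α hf).measurable.pow_const p).ennreal_ofReal

/-- The Gaussian `e^{-b|z|²}`, as an extended nonnegative function. -/
def gauss {n : ℕ} (b : ℝ) (z : Cn n) : ℝ≥0∞ := ENNReal.ofReal (Real.exp (-b * ‖z‖ ^ 2))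

theorem measurable_gauss {n : ℕ} (b : ℝ) : Measurable (gauss (n := n) b) := by
  unfold gauss
  exact (Continuous.measurable (by fun_prop)).ennreal_ofReal

theorem lintegral_gauss_ne_top {n : ℕ} {b : ℝ} (hb : 0 < b) :
    ∫⁻ z : Cn n, gauss b z ≠ ∞ := by
  have hi : Integrable fun z : Cn n => Real.exp (-b * ‖z‖ ^ 2) := by
    by_contra h
    have h1 := GaussianFourier.integral_rexp_neg_mul_sq_norm (V := Cn n) hb
    rw [integral_undef h] at h1
    have : 0 < (Real.pi / b) ^ (Module.finrank ℝ (Cn n) / 2 : ℝ) := by positivity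
    exact this.ne h1
  exact ((hasFiniteIntegral_iff_ofReal (ae_of_all _ fun z => (Real.exp_pos _).le)).1 hi.2).ne

theorem lintegral_ne_zero_of_pos {n : ℕ} {G : Cn n → ℝ≥0∞} (hG : Measurable G)
    (h : ∀ z, G z ≠ 0) : ∫⁻ z, G z ≠ 0 := by
  intro h0
  obtain ⟨z, hz⟩ := ((lintegral_eq_zero_iff hG).1 h0).exists
  exact h z hz

/-- The exponential is holomorphic in w, so the twist keeps f entire while recentring the Gaussian
weight at z. -/
theorem norm_mul_cexp_neg_inner {n : ℕ} (α : ℝ) (f : Cn n → ℂ) (z w : Cn n) :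
    ‖f w * Complex.exp (-(α * inner ℂ z w))‖
      = ‖f w‖ * Real.exp (α / 2 * (‖w - z‖ ^ 2 - ‖w‖ ^ 2 - ‖z‖ ^ 2)) := by
  rw [norm_mul, Complex.norm_exp]
  congr 2
  have h := @norm_sub_sq ℂ (Cn n) _ _ _ w z
  have h2 : (inner ℂ w z : ℂ).re = (inner ℂ z w : ℂ).re := by
    rw [← inner_conj_symm, Complex.conj_re]
  rw [Complex.neg_re, Complex.re_ofReal_mul, h, RCLike.re_eq_complex_re, h2]
  ring

/-- The weighted sub-mean value estimate for entire functions. -/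
theorem exists_wt_rpow_le (n m : ℕ) {α q : ℝ} (hα : 0 < α) (hq : 0 < q) :
    ∃ c : ℝ≥0∞, c ≠ ∞ ∧ ∀ f : Cn n → ℂ, Differentiable ℂ f → ∀ z,
      ENNReal.ofReal (wt m α f z ^ q)
        ≤ c * ∫⁻ w, ENNReal.ofReal (wt m α f w ^ q) * gauss (α * q / 2) (w - z) := by
  have hαq : 0 < α * q := mul_pos hα hq
  -- Half of the Gaussian exponent αq absorbs the growth e^{αq|v|²/2} caused by the twist; the other
  -- half remains in the conclusion. The polynomial factor pays for 1+|z| ≤ (1+|z+v|)(1+|v|).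
  let G : Cn n → ℝ≥0∞ := fun v =>
    ENNReal.ofReal (Real.exp (-(α * q) * ‖v‖ ^ 2) * (((1 + ‖v‖) ^ m) ^ q)⁻¹)
  have hGm : Measurable G := by
    refine Measurable.ennreal_ofReal (Measurable.mul (Continuous.measurable (by fun_prop)) ?_)
    exact (Measurable.pow_const (Continuous.measurable (by fun_prop)) q).inv
  have hone : ∀ v : Cn n, 1 ≤ ((1 + ‖v‖) ^ m) ^ q := fun v =>
    Real.one_le_rpow (one_le_pow₀ (by linarith [norm_nonneg v])) hq.le
  have hG0 : ∫⁻ v, G v ≠ 0 := lintegral_ne_zero_of_pos hGm fun v => by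
    have : 0 < ((1 + ‖v‖) ^ m) ^ q := zero_lt_one.trans_le (hone v)
    simp only [G, ne_eq, ENNReal.ofReal_eq_zero, not_le]
    positivity
  have hGt : ∫⁻ v, G v ≠ ∞ := by
    refine ne_top_of_le_ne_top (lintegral_gauss_ne_top (n := n) hαq) (lintegral_mono fun v => ?_)
    exact ENNReal.ofReal_le_ofReal
      (mul_le_of_le_one_right (Real.exp_pos _).le (inv_le_one_of_one_le₀ (hone v)))
  refine ⟨(∫⁻ v, G v)⁻¹, ENNReal.inv_ne_top.2 hG0, fun f hf z => ?_⟩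
  rw [← ENNReal.div_eq_inv_mul, ENNReal.le_div_iff_mul_le (Or.inl hG0) (Or.inl hGt)]
  let g : Cn n → ℂ := fun w => f w * Complex.exp (-(α * inner ℂ z w))
  have hg : Differentiable ℂ g := by
    refine hf.mul (Differentiable.cexp (Differentiable.neg (Differentiable.const_mul ?_ _)))
    exact (innerSL ℂ z).differentiable
  have hmain := norm_rpow_mul_lintegral_le hg hq z hGm
    (fun c v hc => by simp only [G, norm_smul, hc, one_mul])
  let K : ℝ := ((1 + ‖z‖) ^ m) ^ q * Real.exp (α * q / 2 * ‖z‖ ^ 2)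
  have hK : 0 ≤ K := by positivity
  have hwz : wt m α f z ^ q = K * ‖g z‖ ^ q := by
    simp only [g, K]
    rw [norm_mul_cexp_neg_inner, wt_rpow, Real.mul_rpow (by positivity) (by positivity),
      ← Real.exp_mul, sub_self, norm_zero]
    have : Real.exp (-(α * q / 2) * ‖z‖ ^ 2) = Real.exp (α * q / 2 * ‖z‖ ^ 2) *
        Real.exp (α / 2 * (0 ^ 2 - ‖z‖ ^ 2 - ‖z‖ ^ 2) * q) := by
      rw [← Real.exp_add]; congr 1; ring
    rw [this]; ring
  rw [hwz, ENNReal.ofReal_mul hK, mul_assoc]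
  refine (mul_le_mul_right hmain _).trans ?_
  have hgm : Measurable fun v => ENNReal.ofReal (‖g (z + v)‖ ^ q) :=
    ((hg.continuous.comp (continuous_const.add continuous_id)).norm.measurable.pow_const
      q).ennreal_ofReal
  have hgGm : Measurable fun v => ENNReal.ofReal (‖g (z + v)‖ ^ q) * G v := hgm.mul hGm
  rw [← lintegral_const_mul _ hgGm, ← lintegral_add_left_eq_self (fun w => _ * gauss _ (w - z)) z]
  refine lintegral_mono fun v => ?_
  simp only [add_sub_cancel_left, G, gauss]
  rw [← ENNReal.ofReal_mul (by positivity), ← ENNReal.ofReal_mul hK,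
    ← ENNReal.ofReal_mul (Real.rpow_nonneg (wt_nonneg _ _ _ _) _)]
  refine ENNReal.ofReal_le_ofReal ?_
  simp only [g, K]
  rw [norm_mul_cexp_neg_inner, wt_rpow, Real.mul_rpow (by positivity) (by positivity),
      ← Real.exp_mul, add_sub_cancel_left]
  have hz : ((1 + ‖z‖) ^ m) ^ q ≤ ((1 + ‖z + v‖) ^ m) ^ q * ((1 + ‖v‖) ^ m) ^ q := by
    rw [← Real.mul_rpow (by positivity) (by positivity), ← mul_pow]
    refine Real.rpow_le_rpow (by positivity) (pow_le_pow_left₀ (by positivity) ?_ _) hq.le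
    have h1 : ‖z‖ ≤ ‖z + v‖ + ‖v‖ := by simpa using norm_sub_le (z + v) v
    nlinarith [mul_nonneg (norm_nonneg (z + v)) (norm_nonneg v)]
  have hv0 : 0 < ((1 + ‖v‖) ^ m) ^ q := zero_lt_one.trans_le (hone v)
  have hexp : Real.exp (α * q / 2 * ‖z‖ ^ 2) *
      Real.exp (α / 2 * (‖v‖ ^ 2 - ‖z + v‖ ^ 2 - ‖z‖ ^ 2) * q) *
      Real.exp (-(α * q) * ‖v‖ ^ 2)
      = Real.exp (-(α * q / 2) * ‖z + v‖ ^ 2) * Real.exp (-(α * q / 2) * ‖v‖ ^ 2) := by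
    simp only [← Real.exp_add]; congr 1; ring
  calc _ = ((1 + ‖z‖) ^ m) ^ q * (((1 + ‖v‖) ^ m) ^ q)⁻¹ * ‖f (z + v)‖ ^ q *
        (Real.exp (α * q / 2 * ‖z‖ ^ 2) *
      Real.exp (α / 2 * (‖v‖ ^ 2 - ‖z + v‖ ^ 2 - ‖z‖ ^ 2) * q) *
      Real.exp (-(α * q) * ‖v‖ ^ 2)) := by ring
    _ ≤ ((1 + ‖z + v‖) ^ m) ^ q * ‖f (z + v)‖ ^ q * (Real.exp (-(α * q / 2) * ‖z + v‖ ^ 2) *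
        Real.exp (-(α * q / 2) * ‖v‖ ^ 2)) := by
      rw [hexp]
      refine mul_le_mul_of_nonneg_right (mul_le_mul_of_nonneg_right ?_ (by positivity))
        (by positivity)
      rw [← div_eq_mul_inv, div_le_iff₀ hv0]
      exact hz
    _ = _ := by ring

/-- The integrand of the Fock--Sobolev norm. -/
def fsDens {n : ℕ} (m : ℕ) (α p : ℝ) (f : Cn n → ℂ) (z : Cn n) : ℝ≥0∞ :=
  ENNReal.ofReal (‖z‖ ^ (m * p : ℝ) * ‖f z‖ ^ p * Real.exp (-(α * p / 2) * ‖z‖ ^ 2))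

theorem measurable_fsDens {n : ℕ} (m : ℕ) (α p : ℝ) {f : Cn n → ℂ} (hf : Continuous f) :
    Measurable (fsDens m α p f) := by
  refine Measurable.ennreal_ofReal (Measurable.mul (Measurable.mul ?_ ?_) ?_)
  · exact measurable_norm.pow_const _
  · exact hf.norm.measurable.pow_const _
  · exact Continuous.measurable (by fun_prop)

theorem fsDens_le {n : ℕ} (m : ℕ) (α : ℝ) {p : ℝ} (hp : 0 < p) (f : Cn n → ℂ) (z : Cn n) :
    fsDens m α p f z ≤ ENNReal.ofReal (wt m α f z ^ p) := by
  rw [wt_rpow]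
  refine ENNReal.ofReal_le_ofReal (mul_le_mul_of_nonneg_right
    (mul_le_mul_of_nonneg_right ?_ (by positivity)) (by positivity))
  rw [Real.rpow_mul (norm_nonneg z), Real.rpow_natCast]
  exact Real.rpow_le_rpow (by positivity)
    (pow_le_pow_left₀ (norm_nonneg z) (by linarith) _) hp.le

/-- The weights `(1+|z|)^m` and `|z|^m` define equivalent norms on entire functions. -/
theorem exists_lintegral_wt_rpow_le (n m : ℕ) (hn : 1 ≤ n) {α p : ℝ} (hα : 0 < α) (hp : 0 < p) :
    ∃ c : ℝ≥0∞, c ≠ ∞ ∧ ∀ f : Cn n → ℂ, Differentiable ℂ f →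
      ∫⁻ z, ENNReal.ofReal (wt m α f z ^ p) ≤ c * ∫⁻ z, fsDens m α p f z := by
  have hαp : 0 < α * p := mul_pos hα hp
  -- For |z| ≤ 1 and v in this annulus, 1 ≤ |z+v| ≤ 4. There |·|^{mp} is at least 1 and the Gaussian
  -- is bounded below, so values near the origin are controlled away from it, where |z|^m does not
  -- degenerate.
  let A : Set (Cn n) := {v | 2 ≤ ‖v‖ ∧ ‖v‖ ≤ 3}
  have hAm : MeasurableSet A :=
    (measurableSet_le measurable_const measurable_norm).inter
      (measurableSet_le measurable_norm measurable_const)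
  have hA0 : volume A ≠ 0 := by
    have hopen : IsOpen {v : Cn n | 2 < ‖v‖ ∧ ‖v‖ < 3} :=
      (isOpen_lt continuous_const continuous_norm).inter
        (isOpen_lt continuous_norm continuous_const)
    have hne : {v : Cn n | 2 < ‖v‖ ∧ ‖v‖ < 3}.Nonempty := by
      refine ⟨PiLp.single 2 ⟨0, hn⟩ (5 / 2 : ℂ), ?_⟩
      simp only [Set.mem_ofPred_eq, PiLp.norm_single]
      norm_num
    refine ((hopen.measure_pos volume hne).trans_le (measure_mono ?_)).ne'
    exact fun v hv => ⟨hv.1.le, hv.2.le⟩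
  have hAt : volume A ≠ ∞ := by
    refine ne_top_of_le_ne_top (measure_closedBall_lt_top (x := (0 : Cn n)) (r := 3)).ne
      (measure_mono fun v hv => ?_)
    simpa using hv.2
  let D : ℝ := ((2 : ℝ) ^ m) ^ p
  let E : ℝ := Real.exp (α * p / 2 * 4 ^ 2)
  refine ⟨ENNReal.ofReal D + ENNReal.ofReal D * ((volume A)⁻¹ * ENNReal.ofReal E) *
    volume (Metric.closedBall (0 : Cn n) 1), ?_, fun f hf => ?_⟩
  · refine ENNReal.add_ne_top.2 ⟨ENNReal.ofReal_ne_top, ENNReal.mul_ne_top (ENNReal.mul_ne_top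
      ENNReal.ofReal_ne_top (ENNReal.mul_ne_top (ENNReal.inv_ne_top.2 hA0)
      ENNReal.ofReal_ne_top)) measure_closedBall_lt_top.ne⟩
  set J := ∫⁻ z, fsDens m α p f z with hJ
  have hsmall : ∀ z : Cn n, ‖z‖ ≤ 1 →
      ENNReal.ofReal (‖f z‖ ^ p) ≤ (volume A)⁻¹ * ENNReal.ofReal E * J := by
    intro z hz
    have hm := norm_rpow_mul_lintegral_le hf hp z (G := A.indicator 1)
      (measurable_const.indicator hAm) (fun c v hc => by
        have : c • v ∈ A ↔ v ∈ A := by simp only [A, Set.mem_ofPred_eq, norm_smul, hc, one_mul]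
        by_cases hv : v ∈ A
        · rw [Set.indicator_of_mem hv, Set.indicator_of_mem (this.2 hv)]; rfl
        · rw [Set.indicator_of_notMem hv, Set.indicator_of_notMem (fun h => hv (this.1 h))])
    rw [lintegral_indicator_one hAm] at hm
    rw [mul_assoc, ← ENNReal.div_eq_inv_mul, ENNReal.le_div_iff_mul_le (Or.inl hA0) (Or.inl hAt)]
    refine hm.trans ?_
    rw [hJ, ← lintegral_const_mul _ (measurable_fsDens m α p hf.continuous),
      ← lintegral_add_left_eq_self (fun w => ENNReal.ofReal E * fsDens m α p f w) z]
    refine lintegral_mono fun v => ?_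
    by_cases hv : v ∈ A
    · rw [Set.indicator_of_mem hv, Pi.one_apply, mul_one, fsDens,
        ← ENNReal.ofReal_mul (Real.exp_pos _).le]
      refine ENNReal.ofReal_le_ofReal ?_
      have h1 : 1 ≤ ‖z + v‖ := by
        have : ‖v‖ ≤ ‖z + v‖ + ‖z‖ := by simpa using norm_sub_le (z + v) z
        linarith [hv.1]
      have h4 : ‖z + v‖ ≤ 4 := (norm_add_le _ _).trans (by linarith [hv.2])
      have hr : 1 ≤ ‖z + v‖ ^ (m * p : ℝ) := Real.one_le_rpow h1 (by positivity)
      have he : 1 ≤ E * Real.exp (-(α * p / 2) * ‖z + v‖ ^ 2) := by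
        rw [← Real.exp_add, Real.one_le_exp_iff]
        have : ‖z + v‖ ^ 2 ≤ 4 ^ 2 := pow_le_pow_left₀ (norm_nonneg _) h4 2
        nlinarith
      calc ‖f (z + v)‖ ^ p = 1 * ‖f (z + v)‖ ^ p * 1 := by ring
        _ ≤ ‖z + v‖ ^ (m * p : ℝ) * ‖f (z + v)‖ ^ p *
            (E * Real.exp (-(α * p / 2) * ‖z + v‖ ^ 2)) := by gcongr
        _ = _ := by ring
    · rw [Set.indicator_of_notMem hv, mul_zero]
      exact zero_le
  have hpt : ∀ z : Cn n, ENNReal.ofReal (wt m α f z ^ p) ≤ ENNReal.ofReal D * fsDens m α p f z +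
      (Metric.closedBall (0 : Cn n) 1).indicator
        (fun _ => ENNReal.ofReal D * ((volume A)⁻¹ * ENNReal.ofReal E * J)) z := by
    intro z
    rw [wt_rpow]
    rcases le_total ‖z‖ 1 with hz | hz
    · rw [Set.indicator_of_mem (by simpa using hz)]
      refine le_add_of_nonneg_of_le (zero_le) ?_
      refine le_trans ?_ (mul_le_mul_right (hsmall z hz) _)
      rw [← ENNReal.ofReal_mul (by positivity)]
      refine ENNReal.ofReal_le_ofReal ?_
      have h1 : ((1 + ‖z‖) ^ m) ^ p ≤ D := Real.rpow_le_rpow (by positivity)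
        (pow_le_pow_left₀ (by positivity) (by linarith) _) hp.le
      have h2 : Real.exp (-(α * p / 2) * ‖z‖ ^ 2) ≤ 1 := by
        rw [Real.exp_le_one_iff]
        have : 0 ≤ α * p / 2 * ‖z‖ ^ 2 := by positivity
        linarith
      calc _ ≤ D * ‖f z‖ ^ p * 1 := by gcongr
        _ = _ := mul_one _
    · refine le_add_of_le_of_nonneg ?_ (zero_le)
      rw [fsDens, ← ENNReal.ofReal_mul (by positivity)]
      refine ENNReal.ofReal_le_ofReal ?_
      have h1 : ((1 + ‖z‖) ^ m) ^ p ≤ D * ‖z‖ ^ (m * p : ℝ) := by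
        rw [Real.rpow_mul (norm_nonneg z), Real.rpow_natCast,
          ← Real.mul_rpow (by positivity) (by positivity), ← mul_pow]
        exact Real.rpow_le_rpow (by positivity)
          (pow_le_pow_left₀ (by positivity) (by linarith) _) hp.le
      calc _ ≤ D * ‖z‖ ^ (m * p : ℝ) * ‖f z‖ ^ p * Real.exp (-(α * p / 2) * ‖z‖ ^ 2) := by gcongr
        _ = _ := by ring
  refine (lintegral_mono hpt).trans ?_
  rw [lintegral_add_left ((measurable_fsDens m α p hf.continuous).const_mul _),
    lintegral_const_mul _ (measurable_fsDens m α p hf.continuous),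
    lintegral_indicator_const Metric.isClosed_closedBall.measurableSet, ← hJ]
  refine le_of_eq ?_
  ring

/-! ### Reduction to a Carleson embedding. -/

/-- The density on the source of the measure whose push-forward under `ψ` governs `uC_ψ`. -/
def pullDens {n : ℕ} (m : ℕ) (α q : ℝ) (u : Cn n → ℂ) (ψ : Cn n → Cn n) (z : Cn n) : ℝ≥0∞ :=
  ENNReal.ofReal ((((1 + ‖ψ z‖) ^ m) ^ q)⁻¹ * ‖u z‖ ^ q * ‖z‖ ^ (q * m : ℝ) *
    Real.exp (α * q / 2 * (‖ψ z‖ ^ 2 - ‖z‖ ^ 2)))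

theorem measurable_pullDens {n : ℕ} (m : ℕ) (α q : ℝ) {u : Cn n → ℂ} {ψ : Cn n → Cn n}
    (hu : Continuous u) (hψ : Continuous ψ) : Measurable (pullDens m α q u ψ) := by
  refine Measurable.ennreal_ofReal (Measurable.mul (Measurable.mul (Measurable.mul ?_ ?_) ?_) ?_)
  · exact (Measurable.pow_const (Continuous.measurable (by fun_prop)) q).inv
  · exact hu.norm.measurable.pow_const _
  · exact measurable_norm.pow_const _
  · exact Continuous.measurable (by fun_prop)

theorem norm_kern {n : ℕ} (α : ℝ) (w z : Cn n) :
    ‖kern α w z‖ = Real.exp (α / 2 * (‖z‖ ^ 2 - ‖z - w‖ ^ 2)) := by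
  rw [kern, Complex.norm_exp]
  congr 1
  have h := @norm_sub_sq ℂ (Cn n) _ _ _ z w
  have h2 : (inner ℂ z w : ℂ).re = (inner ℂ w z : ℂ).re := by
    rw [← inner_conj_symm, Complex.conj_re]
  have h3 : ((α : ℂ) * (‖w‖ : ℂ) ^ 2 / 2).re = α * ‖w‖ ^ 2 / 2 := by
    rw [← Complex.ofReal_re (α * ‖w‖ ^ 2 / 2)]
    push_cast; rfl
  rw [Complex.sub_re, Complex.re_ofReal_mul, h3, h, RCLike.re_eq_complex_re, h2]
  ring

/-- Completing the square: |k_w(ζ)| e^{-α|ζ|²/2} = e^{-α|ζ-w|²/2}, taken at ζ = ψ(z). -/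
theorem berezin_eq {n : ℕ} (m : ℕ) (α q : ℝ) (u : Cn n → ℂ) (ψ : Cn n → Cn n) (w : Cn n) :
    berezin n m α q u ψ w = ∫⁻ z, gauss (α * q / 2) (w - ψ z) * pullDens m α q u ψ z := by
  refine lintegral_congr fun z => ?_
  rw [gauss, pullDens, ← ENNReal.ofReal_mul (Real.exp_pos _).le]
  congr 1
  rw [norm_kern, ← Real.exp_mul, Real.rpow_mul (by positivity), Real.rpow_natCast,
    norm_sub_rev w (ψ z)]
  have : Real.exp (α / 2 * (‖ψ z‖ ^ 2 - ‖ψ z - w‖ ^ 2) * q) * Real.exp (-(α * q / 2) * ‖z‖ ^ 2)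
      = Real.exp (-(α * q / 2) * ‖ψ z - w‖ ^ 2) *
        Real.exp (α * q / 2 * (‖ψ z‖ ^ 2 - ‖z‖ ^ 2)) := by
    simp only [← Real.exp_add]; congr 1; ring
  calc _ = (((1 + ‖ψ z‖) ^ m) ^ q)⁻¹ * ‖u z‖ ^ q * ‖z‖ ^ (q * m : ℝ) *
      (Real.exp (α / 2 * (‖ψ z‖ ^ 2 - ‖ψ z - w‖ ^ 2) * q) *
        Real.exp (-(α * q / 2) * ‖z‖ ^ 2)) := by ring
    _ = _ := by rw [this]; ring

theorem measurable_gauss_sub_mul_pullDens {n : ℕ} (m : ℕ) (α q b : ℝ) {u : Cn n → ℂ}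
    {ψ : Cn n → Cn n} (hu : Continuous u) (hψ : Continuous ψ) :
    Measurable fun x : Cn n × Cn n => gauss b (x.1 - ψ x.2) * pullDens m α q u ψ x.2 := by
  refine Measurable.mul ?_ ((measurable_pullDens m α q hu hψ).comp measurable_snd)
  unfold gauss
  exact (Continuous.measurable (by fun_prop)).ennreal_ofReal

theorem measurable_berezin {n : ℕ} (m : ℕ) (α q : ℝ) {u : Cn n → ℂ} {ψ : Cn n → Cn n}
    (hu : Continuous u) (hψ : Continuous ψ) : Measurable (berezin n m α q u ψ) := by
  have : berezin n m α q u ψ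
      = fun w => ∫⁻ z, gauss (α * q / 2) (w - ψ z) * pullDens m α q u ψ z := by
    funext w; exact berezin_eq m α q u ψ w
  rw [this]
  exact (measurable_gauss_sub_mul_pullDens m α q _ hu hψ).lintegral_prod_right'

/-- The factors inserted in `wt` at ψ(z) are exactly those divided out in `pullDens`. Integrating
this identity turns the norm of uC_ψ f into an integral against the push-forward measure. -/
theorem fsDens_wComp {n : ℕ} (m : ℕ) (α q : ℝ) (u : Cn n → ℂ) (ψ : Cn n → Cn n)
    (f : Cn n → ℂ) (z : Cn n) :
    fsDens m α q (wComp u ψ f) z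
      = ENNReal.ofReal (wt m α f (ψ z) ^ q) * pullDens m α q u ψ z := by
  rw [fsDens, pullDens, ← ENNReal.ofReal_mul (Real.rpow_nonneg (wt_nonneg _ _ _ _) _), wt_rpow,
    wComp, norm_mul, Real.mul_rpow (norm_nonneg _) (norm_nonneg _)]
  congr 1
  have hne : ((1 + ‖ψ z‖) ^ m) ^ q ≠ 0 := by positivity
  have : Real.exp (-(α * q / 2) * ‖z‖ ^ 2) = Real.exp (-(α * q / 2) * ‖ψ z‖ ^ 2) *
      Real.exp (α * q / 2 * (‖ψ z‖ ^ 2 - ‖z‖ ^ 2)) := by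
    rw [← Real.exp_add]; congr 1; ring
  rw [this, mul_comm (m : ℝ) q]
  field_simp

theorem normConst_pos {n : ℕ} (m : ℕ) (hn : 1 ≤ n) {α p : ℝ} (hα : 0 < α) (hp : 0 < p) :
    0 < normConst n m α p := by
  have hn' : (0 : ℝ) < n := by exact_mod_cast hn
  have h1 : 0 < Real.Gamma n := Real.Gamma_pos_of_pos hn'
  have h2 : 0 < Real.Gamma (m * p / 2 + n) := Real.Gamma_pos_of_pos (by positivity)
  unfold normConst
  positivity

theorem fsNorm_eq {n : ℕ} (m : ℕ) (α p : ℝ) (f : Cn n → ℂ) :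
    fsNorm n m α p f
      = (ENNReal.ofReal (normConst n m α p) * ∫⁻ z, fsDens m α p f z) ^ (1 / p) := rfl

theorem fsNorm_rpow {n : ℕ} (m : ℕ) (α : ℝ) {p : ℝ} (hp : 0 < p) (f : Cn n → ℂ) :
    fsNorm n m α p f ^ p = ENNReal.ofReal (normConst n m α p) * ∫⁻ z, fsDens m α p f z := by
  rw [fsNorm_eq, ← ENNReal.rpow_mul, one_div_mul_cancel hp.ne', ENNReal.rpow_one]

theorem exists_lintegral_wt_le_fsNorm (n m : ℕ) (hn : 1 ≤ n) {α p : ℝ} (hα : 0 < α) (hp : 0 < p) :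
    ∃ c : ℝ≥0∞, c ≠ ∞ ∧ ∀ f : Cn n → ℂ, Differentiable ℂ f →
      ∫⁻ z, ENNReal.ofReal (wt m α f z ^ p) ≤ c * fsNorm n m α p f ^ p := by
  obtain ⟨c, hc, h⟩ := exists_lintegral_wt_rpow_le n m hn hα hp
  have hk := normConst_pos (n := n) m hn hα hp
  refine ⟨c * (ENNReal.ofReal (normConst n m α p))⁻¹,
    ENNReal.mul_ne_top hc (ENNReal.inv_ne_top.2 (by simpa using hk)), fun f hf => ?_⟩
  rw [fsNorm_rpow m α hp, mul_assoc, ← mul_assoc (ENNReal.ofReal _)⁻¹,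
    ENNReal.inv_mul_cancel (by simpa using hk) ENNReal.ofReal_ne_top, one_mul]
  exact h f hf

theorem exists_fsNorm_rpow_le_lintegral_wt (n m : ℕ) (α : ℝ) {p : ℝ} (hp : 0 < p) :
    ∃ c : ℝ≥0∞, c ≠ ∞ ∧ ∀ f : Cn n → ℂ,
      fsNorm n m α p f ^ p ≤ c * ∫⁻ z, ENNReal.ofReal (wt m α f z ^ p) := by
  refine ⟨ENNReal.ofReal (normConst n m α p), ENNReal.ofReal_ne_top, fun f => ?_⟩
  rw [fsNorm_rpow m α hp]
  exact mul_le_mul_right (lintegral_mono fun z => fsDens_le m α hp f z) _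

/-! ### The upper bound. -/

theorem holderConjugate_div {p q : ℝ} (hq : 0 < q) (hqp : q < p) :
    (p / q).HolderConjugate (p / (p - q)) := by
  rw [Real.holderConjugate_iff]
  refine ⟨(one_lt_div hq).2 hqp, ?_⟩
  have : p ≠ 0 := (hq.trans hqp).ne'
  rw [inv_div, inv_div]
  field_simp
  ring

/-- Hölder's inequality against the weighted modulus of an entire function. -/
theorem exists_lintegral_wt_mul_le (n m : ℕ) (hn : 1 ≤ n) {α p q : ℝ} (hα : 0 < α) (hq : 0 < q)
    (hqp : q < p) :
    ∃ c : ℝ≥0∞, c ≠ ∞ ∧ ∀ f : Cn n → ℂ, Differentiable ℂ f → ∀ B : Cn n → ℝ≥0∞, Measurable B →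
      ∫⁻ w, ENNReal.ofReal (wt m α f w ^ q) * B w
        ≤ c * fsNorm n m α p f ^ q * (∫⁻ w, B w ^ (p / (p - q))) ^ (1 / (p / (p - q))) := by
  have hp : 0 < p := hq.trans hqp
  obtain ⟨c, hc, h⟩ := exists_lintegral_wt_le_fsNorm n m hn hα hp
  refine ⟨c ^ (q / p), ENNReal.rpow_ne_top_of_nonneg (by positivity) hc, fun f hf B hB => ?_⟩
  refine (ENNReal.lintegral_mul_le_Lp_mul_Lq volume (holderConjugate_div hq hqp)
    (measurable_wt_rpow m α q hf.continuous).aemeasurable hB.aemeasurable).trans ?_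
  refine mul_le_mul_left ?_ _
  have e : ∀ w, ENNReal.ofReal (wt m α f w ^ q) ^ (p / q) = ENNReal.ofReal (wt m α f w ^ p) := by
    intro w
    rw [ENNReal.ofReal_rpow_of_nonneg (Real.rpow_nonneg (wt_nonneg _ _ _ _) _) (by positivity),
      ← Real.rpow_mul (wt_nonneg _ _ _ _), mul_div_cancel₀ _ hq.ne']
  simp_rw [e]
  rw [one_div_div]
  refine (ENNReal.rpow_le_rpow (h f hf) (by positivity)).trans (le_of_eq ?_)
  rw [ENNReal.mul_rpow_of_nonneg _ _ (by positivity), ← ENNReal.rpow_mul,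
    mul_div_cancel₀ _ hp.ne']

/-- The norm of `uC_ψ f` is controlled by the Berezin type transform. -/
theorem exists_fsNorm_wComp_le (n m : ℕ) {α q : ℝ} (hα : 0 < α) (hq : 0 < q) :
    ∃ c : ℝ≥0∞, c ≠ ∞ ∧ ∀ (u : Cn n → ℂ) (ψ : Cn n → Cn n), Continuous u → Continuous ψ →
      ∀ f : Cn n → ℂ, Differentiable ℂ f →
      fsNorm n m α q (wComp u ψ f) ^ q
        ≤ c * ∫⁻ w, ENNReal.ofReal (wt m α f w ^ q) * berezin n m α q u ψ w := by
  obtain ⟨c, hc, h⟩ := exists_wt_rpow_le n m hα hq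
  refine ⟨ENNReal.ofReal (normConst n m α q) * c, ENNReal.mul_ne_top ENNReal.ofReal_ne_top hc,
    fun u ψ hu hψ f hf => ?_⟩
  rw [fsNorm_rpow m α hq, mul_assoc]
  refine mul_le_mul_right ?_ _
  have hwm := measurable_wt_rpow m α q hf.continuous
  have hgm := measurable_gauss_sub_mul_pullDens m α q (α * q / 2) hu hψ
  have hgm1 : ∀ z, Measurable fun w : Cn n => gauss (α * q / 2) (w - ψ z) := fun z =>
    (measurable_gauss _).comp (measurable_id.sub_const _)
  have hgm2 : ∀ w, Measurable fun z : Cn n =>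
      gauss (α * q / 2) (w - ψ z) * pullDens m α q u ψ z := fun w =>
    ((measurable_gauss _).comp (hψ.measurable.const_sub w)).mul (measurable_pullDens m α q hu hψ)
  -- The sub-mean value estimate is used at ψ(z); after Tonelli the inner integral in z is the
  -- Berezin type transform at w.
  calc ∫⁻ z, fsDens m α q (wComp u ψ f) z
      ≤ ∫⁻ z, c * ∫⁻ w, ENNReal.ofReal (wt m α f w ^ q) *
          (gauss (α * q / 2) (w - ψ z) * pullDens m α q u ψ z) := by
        refine lintegral_mono fun z => ?_
        dsimp only
        rw [fsDens_wComp]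
        refine (mul_le_mul_left (h f hf (ψ z)) _).trans (le_of_eq ?_)
        have hm : Measurable fun w =>
            ENNReal.ofReal (wt m α f w ^ q) * gauss (α * q / 2) (w - ψ z) := hwm.mul (hgm1 z)
        rw [mul_assoc, ← lintegral_mul_const _ hm]
        simp_rw [mul_assoc]
    _ = c * ∫⁻ z, ∫⁻ w, ENNReal.ofReal (wt m α f w ^ q) *
          (gauss (α * q / 2) (w - ψ z) * pullDens m α q u ψ z) :=
        lintegral_const_mul' _ _ hc
    _ = c * ∫⁻ w, ∫⁻ z, ENNReal.ofReal (wt m α f w ^ q) *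
          (gauss (α * q / 2) (w - ψ z) * pullDens m α q u ψ z) := by
        congr 1
        refine (lintegral_lintegral_swap (Measurable.aemeasurable ?_)).symm
        exact (hwm.comp measurable_fst).mul hgm
    _ = _ := by
        congr 1
        refine lintegral_congr fun w => ?_
        rw [lintegral_const_mul _ (hgm2 w), berezin_eq]

theorem eLpNorm_ennreal {n : ℕ} {s : ℝ} (hs : 0 < s) (B : Cn n → ℝ≥0∞) :
    eLpNorm B (ENNReal.ofReal s) volume = (∫⁻ w, B w ^ s) ^ (1 / s) := by
  rw [eLpNorm_eq_lintegral_rpow_enorm_toReal (by simpa using hs) ENNReal.ofReal_ne_top,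
    ENNReal.toReal_ofReal hs.le]
  simp

/-- The upper bound for the norm of `uC_ψ f`. -/
theorem exists_fsNorm_wComp_le_eLpNorm (n m : ℕ) (hn : 1 ≤ n) {α p q : ℝ} (hα : 0 < α)
    (hq : 0 < q) (hqp : q < p) :
    ∃ C : ℝ≥0∞, C ≠ ∞ ∧ ∀ (u : Cn n → ℂ) (ψ : Cn n → Cn n), Continuous u → Continuous ψ →
      ∀ f : Cn n → ℂ, Differentiable ℂ f →
      fsNorm n m α q (wComp u ψ f)
        ≤ C * eLpNorm (berezin n m α q u ψ) (ENNReal.ofReal (p / (p - q))) volume ^ (1 / q) *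
          fsNorm n m α p f := by
  have hp : 0 < p := hq.trans hqp
  obtain ⟨c, hc, h⟩ := exists_fsNorm_wComp_le n m hα hq
  obtain ⟨d, hd, h'⟩ := exists_lintegral_wt_mul_le n m hn hα hq hqp
  refine ⟨(c * d) ^ (1 / q), ENNReal.rpow_ne_top_of_nonneg (by positivity)
    (ENNReal.mul_ne_top hc hd), fun u ψ hu hψ f hf => ?_⟩
  rw [eLpNorm_ennreal (div_pos hp (sub_pos.2 hqp)), ← ENNReal.rpow_le_rpow_iff hq]
  refine (h u ψ hu hψ f hf).trans
    ((mul_le_mul_right (h' f hf _ (measurable_berezin m α q hu hψ)) c).trans (le_of_eq ?_))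
  rw [ENNReal.mul_rpow_of_nonneg _ _ hq.le, ENNReal.mul_rpow_of_nonneg _ _ hq.le,
    ← ENNReal.rpow_mul, ← ENNReal.rpow_mul _ (1 / q) q, one_div_mul_cancel hq.ne',
    ENNReal.rpow_one, ENNReal.rpow_one]
  ring

/-! ### Cauchy estimates and Montel's theorem. -/

/-- The Cauchy estimate for the derivative of an entire function on `ℂⁿ`. -/
theorem norm_fderiv_le_of_forall_closedBall {n : ℕ} {g : Cn n → ℂ} (hg : Differentiable ℂ g)
    {z : Cn n} {M : ℝ} (hM : ∀ w ∈ Metric.closedBall z 1, ‖g w‖ ≤ M) : ‖fderiv ℂ g z‖ ≤ M := by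
  have hM0 : 0 ≤ M := (norm_nonneg _).trans (hM z (Metric.mem_closedBall_self zero_le_one))
  refine ContinuousLinearMap.opNorm_le_bound _ hM0 fun v => ?_
  rcases eq_or_ne v 0 with rfl | hv
  · simp
  have hvpos : 0 < ‖v‖ := norm_pos_iff.2 hv
  have hline : HasDerivAt (fun t : ℂ => z + t • v) v 0 := by
    simpa using ((hasDerivAt_id (0 : ℂ)).smul_const v).const_add z
  have hder : HasDerivAt (fun t : ℂ => g (z + t • v)) (fderiv ℂ g z v) 0 := by
    have h := (hg (z + (0 : ℂ) • v)).hasFDerivAt.comp_hasDerivAt (0 : ℂ) hline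
    rw [zero_smul, add_zero] at h
    exact h
  have hd : Differentiable ℂ fun t : ℂ => g (z + t • v) :=
    hg.comp ((differentiable_const z).add (differentiable_id.smul_const v))
  -- The radius 1/‖v‖ is the largest for which z + tv stays in the closed unit ball about z.
  have h := Complex.norm_deriv_le_of_forall_mem_sphere_norm_le (c := 0) (inv_pos.2 hvpos)
    hd.diffContOnCl (C := M) (fun t ht => hM _ ?_)
  · rw [hder.deriv, div_inv_eq_mul] at h
    exact h
  · have : ‖t‖ = ‖v‖⁻¹ := by simpa using ht
    rw [mem_closedBall_iff_norm, add_sub_cancel_left, norm_smul, this, inv_mul_cancel₀ hvpos.ne']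

/-- Montel's theorem on `ℂⁿ`: a locally bounded sequence of entire functions has a subsequence
converging pointwise to an entire function. -/
theorem exists_subseq_tendsto_differentiable {n : ℕ} {f : ℕ → Cn n → ℂ}
    (hf : ∀ j, Differentiable ℂ (f j)) {M : ℝ → ℝ} (hM : ∀ R j z, ‖z‖ ≤ R → ‖f j z‖ ≤ M R) :
    ∃ φ : ℕ → ℕ, StrictMono φ ∧ ∃ g : Cn n → ℂ, Differentiable ℂ g ∧
      ∀ z, Tendsto (fun j => f (φ j) z) atTop (𝓝 (g z)) := by
  -- The Lipschitz constant `M (R + 1)` comes from the Cauchy estimate on unit balls. Both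
  -- conditions are closed in the product topology, so `T` is compact by Tychonoff; Arzelà–Ascoli
  -- transfers this to locally uniform convergence.
  let T : Set (Cn n → ℂ) := {h | (∀ z, h z ∈ Metric.closedBall (0 : ℂ) (M ‖z‖)) ∧
    ∀ R : ℝ, 0 ≤ R → ∀ z w, ‖z‖ ≤ R → ‖w‖ ≤ R → dist (h z) (h w) ≤ M (R + 1) * dist z w}
  have hTcompact : IsCompact T := by
    refine IsCompact.of_isClosed_subset
      (isCompact_univ_pi fun z : Cn n => isCompact_closedBall (0 : ℂ) (M ‖z‖)) ?_
      fun h hh z _ => hh.1 z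
    have h1 : IsClosed {h : Cn n → ℂ | ∀ z, h z ∈ Metric.closedBall (0 : ℂ) (M ‖z‖)} := by
      rw [Set.ofPred_forall]
      exact isClosed_iInter fun z => Metric.isClosed_closedBall.preimage (continuous_apply z)
    have h2 : IsClosed {h : Cn n → ℂ | ∀ R : ℝ, 0 ≤ R → ∀ z w, ‖z‖ ≤ R → ‖w‖ ≤ R →
        dist (h z) (h w) ≤ M (R + 1) * dist z w} := by
      simp only [Set.ofPred_forall]
      refine isClosed_iInter fun R => isClosed_iInter fun _ => isClosed_iInter fun z =>
        isClosed_iInter fun w => isClosed_iInter fun _ => isClosed_iInter fun _ => ?_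
      exact isClosed_le ((continuous_apply z).dist (continuous_apply w)) continuous_const
    exact h1.inter h2
  have hmod : ∀ z₀ : Cn n, ∀ᶠ z in 𝓝 z₀, ∀ h ∈ T,
      dist (h z₀) (h z) ≤ M (‖z₀‖ + 1 + 1) * dist z₀ z := by
    intro z₀
    filter_upwards [Metric.ball_mem_nhds z₀ one_pos] with z hz h hh
    refine hh.2 _ (by positivity) _ _ (by linarith) ?_
    have h1 : ‖z - z₀‖ < 1 := by rwa [mem_ball_iff_norm] at hz
    have h2 : ‖z‖ ≤ ‖z - z₀‖ + ‖z₀‖ := norm_le_norm_sub_add z z₀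
    linarith
  have hlim : ∀ z₀ : Cn n, Tendsto (fun z => M (‖z₀‖ + 1 + 1) * dist z₀ z) (𝓝 z₀) (𝓝 0) := by
    intro z₀
    have : Continuous fun z => M (‖z₀‖ + 1 + 1) * dist z₀ z := by fun_prop
    simpa using this.tendsto z₀
  let S : Set C(Cn n, ℂ) := {F | (F : Cn n → ℂ) ∈ T}
  have hST : ContinuousMap.toFun '' S = T := by
    ext h
    refine ⟨?_, fun hh => ?_⟩
    · rintro ⟨F, hF, rfl⟩; exact hF
    · have hc : Continuous h := by
        rw [continuous_iff_continuousAt]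
        intro z₀
        rw [ContinuousAt, tendsto_iff_dist_tendsto_zero]
        refine squeeze_zero' (Eventually.of_forall fun _ => dist_nonneg) ?_ (hlim z₀)
        filter_upwards [hmod z₀] with z hz
        rw [dist_comm]
        exact hz h hh
      exact ⟨⟨h, hc⟩, hh, rfl⟩
  have hScompact : IsCompact S := by
    refine ArzelaAscoli.isCompact_of_equicontinuous S (hST ▸ hTcompact) fun z₀ => ?_
    refine Metric.equicontinuousAt_of_continuity_modulus _ (hlim z₀) _ ?_
    filter_upwards [hmod z₀] with z hz F
    exact hz _ F.2
  let F : ℕ → C(Cn n, ℂ) := fun j => ⟨f j, (hf j).continuous⟩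
  have hFS : ∀ j, F j ∈ S := by
    intro j
    refine ⟨fun z => mem_closedBall_zero_iff.2 (hM ‖z‖ j z le_rfl), fun R hR z w hz hw => ?_⟩
    have hconv := (convex_closedBall (0 : Cn n) R).norm_image_sub_le_of_norm_fderiv_le (𝕜 := ℂ)
      (f := f j) (C := M (R + 1)) (fun x _ => hf j x)
      (fun x hx => norm_fderiv_le_of_forall_closedBall (hf j) fun y hy => hM _ j y ?_)
      (x := w) (y := z) (by simpa using hw) (by simpa using hz)
    · rwa [← dist_eq_norm, ← dist_eq_norm] at hconv
    · have h1 : ‖y - x‖ ≤ 1 := by rwa [mem_closedBall_iff_norm] at hy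
      have h2 : ‖x‖ ≤ R := by simpa using hx
      have := norm_le_norm_sub_add y x
      linarith
  obtain ⟨G, -, φ, hφ, hlimG⟩ := hScompact.tendsto_subseq hFS
  have hunif := ContinuousMap.tendsto_iff_forall_isCompact_tendstoUniformlyOn.1 hlimG
  have hpt : ∀ z, Tendsto (fun j => f (φ j) z) atTop (𝓝 (G z)) := fun z =>
    (hunif {z} isCompact_singleton).tendsto_at (Set.mem_singleton z)
  refine ⟨φ, hφ, G, fun z₀ => ?_, hpt⟩
  -- The Cauchy estimate applied to differences turns uniform convergence on the ball of radius 2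
  -- into uniformly Cauchy derivatives on the ball of radius 1, whence the limit is differentiable.
  have hcauchy : UniformCauchySeqOn (fun j => fderiv ℂ (f (φ j))) atTop (Metric.ball z₀ 1) := by
    rw [Metric.uniformCauchySeqOn_iff]
    intro ε hε
    obtain ⟨N, hN⟩ := Metric.uniformCauchySeqOn_iff.1
      (hunif _ (isCompact_closedBall z₀ 2)).uniformCauchySeqOn (ε / 2) (half_pos hε)
    refine ⟨N, fun a ha b hb x hx => ?_⟩
    rw [dist_eq_norm, ← fderiv_sub (hf _ x) (hf _ x)]
    refine (norm_fderiv_le_of_forall_closedBall ((hf _).sub (hf _)) (M := ε / 2)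
      fun w hw => ?_).trans_lt (half_lt_self hε)
    have := hN a ha b hb w ?_
    · rw [dist_eq_norm] at this
      exact this.le
    · rw [Metric.mem_closedBall] at hw ⊢
      rw [Metric.mem_ball] at hx
      linarith [dist_triangle w x z₀]
  have hlimd : ∀ x : Cn n, ∃ L : Cn n →L[ℂ] ℂ, x ∈ Metric.ball z₀ 1 →
      Tendsto (fun j => fderiv ℂ (f (φ j)) x) atTop (𝓝 L) := by
    intro x
    by_cases hx : x ∈ Metric.ball z₀ 1
    · obtain ⟨L, hL⟩ := cauchySeq_tendsto_of_complete (hcauchy.cauchySeq hx)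
      exact ⟨L, fun _ => hL⟩
    · exact ⟨0, fun h => absurd h hx⟩
  choose G' hG' using hlimd
  exact (hasFDerivAt_of_tendstoUniformlyOn Metric.isOpen_ball
    (hcauchy.tendstoUniformlyOn_of_tendsto hG') (fun j x _ => (hf _ x).hasFDerivAt)
    (fun x _ => hpt x) (Metric.mem_ball_self one_pos)).differentiableAt

/-! ### Compactness from integrability of the transform. -/

theorem gauss_le_one {n : ℕ} {b : ℝ} (hb : 0 ≤ b) (z : Cn n) : gauss b z ≤ 1 := by
  rw [gauss, ENNReal.ofReal_le_one, Real.exp_le_one_iff]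
  have : 0 ≤ b * ‖z‖ ^ 2 := by positivity
  linarith

theorem exists_wt_rpow_le_fsNorm (n m : ℕ) (hn : 1 ≤ n) {α p : ℝ} (hα : 0 < α) (hp : 0 < p) :
    ∃ c : ℝ≥0∞, c ≠ ∞ ∧ ∀ f : Cn n → ℂ, Differentiable ℂ f → ∀ z,
      ENNReal.ofReal (wt m α f z ^ p) ≤ c * fsNorm n m α p f ^ p := by
  obtain ⟨c, hc, h⟩ := exists_wt_rpow_le n m hα hp
  obtain ⟨d, hd, h'⟩ := exists_lintegral_wt_le_fsNorm n m hn hα hp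
  refine ⟨c * d, ENNReal.mul_ne_top hc hd, fun f hf z => (h f hf z).trans ?_⟩
  rw [mul_assoc]
  refine mul_le_mul_right ((lintegral_mono fun w => ?_).trans (h' f hf)) c
  exact mul_le_of_le_one_right' (gauss_le_one (by positivity) _)

/-- This replaces the triangle inequality uniformly in p > 0, so exponents below 1 need no separate
treatment. -/
theorem rpow_le_of_le_add {p a b c : ℝ} (hp : 0 < p) (ha : 0 ≤ a) (hb : 0 ≤ b) (hc : 0 ≤ c)
    (h : a ≤ b + c) : a ^ p ≤ 2 ^ p * (b ^ p + c ^ p) := by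
  have h0 : 0 ≤ max b c := hb.trans (le_max_left _ _)
  have h1 : a ≤ 2 * max b c := by linarith [le_max_left b c, le_max_right b c]
  refine (Real.rpow_le_rpow ha h1 hp.le).trans ?_
  rw [Real.mul_rpow zero_le_two h0]
  refine mul_le_mul_of_nonneg_left ?_ (by positivity)
  rcases max_choice b c with e | e <;> rw [e]
  · linarith [Real.rpow_nonneg hc p]
  · linarith [Real.rpow_nonneg hb p]

theorem fsNorm_rpow_le_of_norm_le {n : ℕ} (m : ℕ) (α : ℝ) {p : ℝ} (hp : 0 < p)
    {f g h : Cn n → ℂ} (hf : Continuous f) (hle : ∀ z, ‖h z‖ ≤ ‖f z‖ + ‖g z‖) :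
    fsNorm n m α p h ^ p
      ≤ ENNReal.ofReal (2 ^ p) * (fsNorm n m α p f ^ p + fsNorm n m α p g ^ p) := by
  rw [fsNorm_rpow m α hp, fsNorm_rpow m α hp, fsNorm_rpow m α hp, ← mul_add, mul_left_comm,
    ← lintegral_add_left (measurable_fsDens m α p hf)]
  refine mul_le_mul_right ?_ _
  rw [← lintegral_const_mul' _ _ ENNReal.ofReal_ne_top]
  refine lintegral_mono fun z => ?_
  dsimp only
  rw [fsDens, fsDens, fsDens, ← ENNReal.ofReal_add (by positivity) (by positivity),
    ← ENNReal.ofReal_mul (by positivity)]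
  refine ENNReal.ofReal_le_ofReal ?_
  calc _ ≤ ‖z‖ ^ (m * p : ℝ) * (2 ^ p * (‖f z‖ ^ p + ‖g z‖ ^ p)) *
        Real.exp (-(α * p / 2) * ‖z‖ ^ 2) := by
        refine mul_le_mul_of_nonneg_right (mul_le_mul_of_nonneg_left
          (rpow_le_of_le_add hp (norm_nonneg _) (norm_nonneg _) (norm_nonneg _) (hle z))
          (by positivity)) (by positivity)
    _ = _ := by ring

theorem fsNorm_const_mul {n : ℕ} (m : ℕ) (α : ℝ) {p : ℝ} (hp : 0 < p) (c : ℂ) (f : Cn n → ℂ) :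
    fsNorm n m α p (fun z => c * f z) = ENNReal.ofReal ‖c‖ * fsNorm n m α p f := by
  have h : ∀ z, fsDens m α p (fun z => c * f z) z
      = ENNReal.ofReal (‖c‖ ^ p) * fsDens m α p f z := by
    intro z
    rw [fsDens, fsDens, ← ENNReal.ofReal_mul (by positivity), norm_mul,
      Real.mul_rpow (norm_nonneg _) (norm_nonneg _)]
    ring_nf
  rw [fsNorm_eq, fsNorm_eq, lintegral_congr h, lintegral_const_mul' _ _ ENNReal.ofReal_ne_top,
    mul_left_comm, ENNReal.mul_rpow_of_nonneg _ _ (by positivity),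
    ENNReal.ofReal_rpow_of_nonneg (by positivity) (by positivity), ← Real.rpow_mul (norm_nonneg _),
    mul_one_div_cancel hp.ne', Real.rpow_one]

theorem tendsto_fsDens {n : ℕ} (m : ℕ) (α : ℝ) {p : ℝ} (hp : 0 < p) {f : ℕ → Cn n → ℂ}
    {g : Cn n → ℂ} {z : Cn n} (h : Tendsto (fun j => f j z) atTop (𝓝 (g z))) :
    Tendsto (fun j => fsDens m α p (f j) z) atTop (𝓝 (fsDens m α p g z)) :=
  ENNReal.tendsto_ofReal (((h.norm.rpow_const (Or.inr hp.le)).const_mul _).mul_const _)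

/-- Fatou's lemma; it keeps the limit supplied by Montel's theorem in the space. -/
theorem fsNorm_le_of_tendsto {n : ℕ} (m : ℕ) (α : ℝ) {p : ℝ} (hp : 0 < p) {f : ℕ → Cn n → ℂ}
    {g : Cn n → ℂ} (hf : ∀ j, Continuous (f j)) (h : ∀ z, Tendsto (fun j => f j z) atTop (𝓝 (g z)))
    {R : ℝ≥0∞} (hR : ∀ j, fsNorm n m α p (f j) ≤ R) : fsNorm n m α p g ≤ R := by
  rw [← ENNReal.rpow_le_rpow_iff hp, fsNorm_rpow m α hp]
  have h1 : ∫⁻ z, fsDens m α p g z ≤ liminf (fun j => ∫⁻ z, fsDens m α p (f j) z) atTop := by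
    refine le_trans (le_of_eq (lintegral_congr fun z => ?_))
      (lintegral_liminf_le fun j => measurable_fsDens m α p (hf j))
    exact (tendsto_fsDens m α hp (h z)).liminf_eq.symm
  have h2 : ∀ j, ENNReal.ofReal (normConst n m α p) * ∫⁻ z, fsDens m α p (f j) z ≤ R ^ p := by
    intro j
    rw [← fsNorm_rpow m α hp]
    exact ENNReal.rpow_le_rpow (hR j) hp.le
  -- Positivity of the constant is not available under these hypotheses, so its vanishing is treated
  -- apart before dividing.
  rcases eq_or_ne (ENNReal.ofReal (normConst n m α p)) 0 with h0 | h0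
  · rw [h0, zero_mul]; exact zero_le
  rw [mul_comm, ← ENNReal.le_div_iff_mul_le (Or.inl h0) (Or.inl ENNReal.ofReal_ne_top)]
  refine h1.trans ?_
  refine (liminf_le_limsup).trans (limsup_le_of_le (by isBoundedDefault) (Eventually.of_forall ?_))
  intro j
  rw [ENNReal.le_div_iff_mul_le (Or.inl h0) (Or.inl ENNReal.ofReal_ne_top), mul_comm]
  exact h2 j

/-- If `B ∈ L^{p/(p-q)}`, then `∫ wt(h_j)^q B → 0` for every bounded sequence `h_j` of the
Fock--Sobolev space that converges pointwise to zero. -/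
theorem tendsto_lintegral_wt_mul (n m : ℕ) (hn : 1 ≤ n) {α p q : ℝ} (hα : 0 < α) (hq : 0 < q)
    (hqp : q < p) {B : Cn n → ℝ≥0∞} (hB : Measurable B) (hBs : ∫⁻ w, B w ^ (p / (p - q)) ≠ ∞)
    {h : ℕ → Cn n → ℂ} (hh : ∀ j, Differentiable ℂ (h j)) {R : ℝ≥0∞} (hR : R ≠ ∞)
    (hhR : ∀ j, fsNorm n m α p (h j) ≤ R) (hlim : ∀ z, Tendsto (fun j => h j z) atTop (𝓝 0)) :
    Tendsto (fun j => ∫⁻ w, ENNReal.ofReal (wt m α (h j) w ^ q) * B w) atTop (𝓝 0) := by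
  have hp : 0 < p := hq.trans hqp
  have hs : 1 < p / (p - q) := (one_lt_div (sub_pos.2 hqp)).2 (by linarith)
  obtain ⟨c, hc, hcf⟩ := exists_lintegral_wt_mul_le n m hn hα hq hqp
  obtain ⟨d, hd, hdf⟩ := exists_wt_rpow_le_fsNorm n m hn hα hp
  -- Outside a large ball Hölder uses the small tail of `B`, uniformly in j; inside it dominated
  -- convergence applies.
  let A : ℕ → Set (Cn n) := fun N => Metric.closedBall 0 N
  have hA : ∀ N, MeasurableSet (A N) := fun N => Metric.isClosed_closedBall.measurableSet
  have htail : Tendsto (fun N : ℕ => ∫⁻ w, ((A N)ᶜ.indicator B w) ^ (p / (p - q))) atTop (𝓝 0) := by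
    rw [show (0 : ℝ≥0∞) = ∫⁻ _ : Cn n, (0 : ℝ≥0∞) by simp]
    refine tendsto_lintegral_of_dominated_convergence (fun w => B w ^ (p / (p - q)))
      (fun N => (hB.indicator (hA N).compl).pow_const _) (fun N => ae_of_all _ fun w => ?_) hBs
      (ae_of_all _ fun w => ?_)
    · exact ENNReal.rpow_le_rpow (Set.indicator_le_self _ _ _) (by linarith)
    · refine tendsto_const_nhds.congr' ?_
      filter_upwards [eventually_ge_atTop ⌈‖w‖⌉₊] with N hN
      rw [Set.indicator_of_notMem, ENNReal.zero_rpow_of_pos (by linarith)]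
      rw [Set.notMem_compl_iff]
      exact mem_closedBall_zero_iff.2 (Nat.ceil_le.1 hN)
  have htail' : Tendsto (fun N : ℕ => c * R ^ q *
      (∫⁻ w, ((A N)ᶜ.indicator B w) ^ (p / (p - q))) ^ (1 / (p / (p - q)))) atTop (𝓝 0) := by
    have h1 := (ENNReal.continuous_rpow_const (y := 1 / (p / (p - q)))).tendsto 0
    rw [ENNReal.zero_rpow_of_pos (by positivity)] at h1
    have h2 := ENNReal.Tendsto.const_mul (h1.comp htail) (Or.inr
      (ENNReal.mul_ne_top hc (ENNReal.rpow_ne_top_of_nonneg hq.le hR)))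
    rwa [mul_zero] at h2
  -- The exponent exceeds 1, so B ≤ 1 + B^{p/(p-q)}, which is integrable on balls.
  have hloc : ∀ N, ∫⁻ w in A N, B w ≠ ∞ := by
    intro N
    refine ne_top_of_le_ne_top (b := volume (A N) + ∫⁻ w, B w ^ (p / (p - q)))
      (ENNReal.add_ne_top.2 ⟨measure_closedBall_lt_top.ne, hBs⟩) ?_
    calc ∫⁻ w in A N, B w ≤ ∫⁻ w in A N, (1 + B w ^ (p / (p - q))) := by
          refine lintegral_mono fun w => ?_
          rcases le_total (B w) 1 with h1 | h1
          · exact h1.trans le_self_add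
          · refine le_trans ?_ le_add_self
            simpa using ENNReal.rpow_le_rpow_of_exponent_le h1 hs.le
      _ ≤ _ := by
          rw [lintegral_add_left measurable_const, setLIntegral_one]
          gcongr
          exact Measure.restrict_le_self
  have hnear : ∀ N, Tendsto (fun j => ∫⁻ w in A N, ENNReal.ofReal (wt m α (h j) w ^ q) * B w)
      atTop (𝓝 0) := by
    intro N
    let K : ℝ≥0∞ := (d * R ^ p) ^ (q / p)
    have hK : K ≠ ∞ := ENNReal.rpow_ne_top_of_nonneg (by positivity)
      (ENNReal.mul_ne_top hd (ENNReal.rpow_ne_top_of_nonneg hp.le hR))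
    have hbd : ∀ j w, ENNReal.ofReal (wt m α (h j) w ^ q) ≤ K := by
      intro j w
      have h1 : ENNReal.ofReal (wt m α (h j) w ^ q)
          = ENNReal.ofReal (wt m α (h j) w ^ p) ^ (q / p) := by
        rw [ENNReal.ofReal_rpow_of_nonneg (Real.rpow_nonneg (wt_nonneg _ _ _ _) _)
          (by positivity), ← Real.rpow_mul (wt_nonneg _ _ _ _), mul_div_cancel₀ _ hp.ne']
      rw [h1]
      refine ENNReal.rpow_le_rpow ((hdf _ (hh j) w).trans ?_) (by positivity)
      exact mul_le_mul_right (ENNReal.rpow_le_rpow (hhR j) hp.le) _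
    rw [show (0 : ℝ≥0∞) = ∫⁻ _ in A N, (0 : ℝ≥0∞) by simp]
    refine tendsto_lintegral_filter_of_dominated_convergence (fun w => K * B w)
      (Eventually.of_forall fun j => (measurable_wt_rpow m α q (hh j).continuous).mul hB)
      (Eventually.of_forall fun j => ae_of_all _ fun w => mul_le_mul_left (hbd j w) _) ?_ ?_
    · rw [lintegral_const_mul _ hB]
      exact ENNReal.mul_ne_top hK (hloc N)
    · filter_upwards [ae_lt_top hB (hloc N)] with w hw
      have h1 : Tendsto (fun j => wt m α (h j) w) atTop (𝓝 0) := by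
        have h2 := (((hlim w).norm.const_mul ((1 + ‖w‖) ^ m)).mul_const
          (Real.exp (-(α / 2) * ‖w‖ ^ 2)))
        simpa [wt] using h2
      have h3 : Tendsto (fun j => ENNReal.ofReal (wt m α (h j) w ^ q)) atTop (𝓝 0) := by
        have := ENNReal.tendsto_ofReal (h1.rpow_const (p := q) (Or.inr hq.le))
        simpa [Real.zero_rpow hq.ne'] using this
      simpa using ENNReal.Tendsto.mul_const h3 (Or.inr hw.ne)
  rw [ENNReal.tendsto_nhds_zero]
  intro ε hε
  have hε2 : 0 < ε / 2 := ENNReal.half_pos hε.ne'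
  obtain ⟨N, hN⟩ := (ENNReal.tendsto_nhds_zero.1 htail' _ hε2).exists
  filter_upwards [ENNReal.tendsto_nhds_zero.1 (hnear N) _ hε2] with j hj
  rw [← lintegral_add_compl _ (hA N), ← ENNReal.add_halves ε]
  refine add_le_add hj (le_trans ?_ hN)
  rw [← lintegral_indicator (hA N).compl]
  have h1 : ∀ w, (A N)ᶜ.indicator (fun w => ENNReal.ofReal (wt m α (h j) w ^ q) * B w) w
      = ENNReal.ofReal (wt m α (h j) w ^ q) * (A N)ᶜ.indicator B w := by
    intro w
    by_cases hw : w ∈ (A N)ᶜ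
    · rw [Set.indicator_of_mem hw, Set.indicator_of_mem hw]
    · rw [Set.indicator_of_notMem hw, Set.indicator_of_notMem hw, mul_zero]
  rw [lintegral_congr h1]
  refine (hcf _ (hh j) _ (hB.indicator (hA N).compl)).trans ?_
  gcongr
  exact hhR j

/-- The pointwise bound on `wt` makes a bounded sequence locally bounded, so Montel applies. The
differences from the limit are bounded and tend pointwise to 0, hence `tendsto_lintegral_wt_mul`
sends their images to 0. -/
theorem isCompactOp_of_memLp {n : ℕ} (m : ℕ) (hn : 1 ≤ n) {α p q : ℝ} (hα : 0 < α) (hq : 0 < q)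
    (hqp : q < p) {u : Cn n → ℂ} {ψ : Cn n → Cn n} (hu : Differentiable ℂ u)
    (hψ : Differentiable ℂ ψ)
    (hB : MemLp (berezin n m α q u ψ) (ENNReal.ofReal (p / (p - q))) volume) :
    IsCompactOp n m α p q u ψ := by
  have hp : 0 < p := hq.trans hqp
  have hs : 0 < p / (p - q) := div_pos hp (sub_pos.2 hqp)
  have hBm := measurable_berezin m α q hu.continuous hψ.continuous
  have hBs : ∫⁻ w, berezin n m α q u ψ w ^ (p / (p - q)) ≠ ∞ := by
    intro htop
    have h1 := hB.2
    rw [eLpNorm_ennreal hs, htop, ENNReal.top_rpow_of_pos (by positivity)] at h1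
    exact lt_irrefl _ h1
  have hmaps : ∀ f ∈ fsSpace n m α p, wComp u ψ f ∈ fsSpace n m α q := by
    obtain ⟨C, hC, hCf⟩ := exists_fsNorm_wComp_le_eLpNorm n m hn hα hq hqp
    rintro f ⟨hf, hfn⟩
    refine ⟨hu.mul (hf.comp hψ), (hCf u ψ hu.continuous hψ.continuous f hf).trans_lt ?_⟩
    exact ENNReal.mul_lt_top (ENNReal.mul_lt_top hC.lt_top
      (ENNReal.rpow_lt_top_of_nonneg (by positivity) hB.2.ne)) hfn
  refine ⟨hmaps, fun f hf ⟨R, hR⟩ => ?_⟩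
  obtain ⟨d, hd, hdf⟩ := exists_wt_rpow_le_fsNorm n m hn hα hp
  have hKtop : d * (R : ℝ≥0∞) ^ p ≠ ∞ :=
    ENNReal.mul_ne_top hd (ENNReal.rpow_ne_top_of_nonneg hp.le ENNReal.coe_ne_top)
  let K : ℝ := ((d * (R : ℝ≥0∞) ^ p).toReal) ^ (1 / p)
  have hwtK : ∀ j z, wt m α (f j) z ≤ K := by
    intro j z
    have h1 : ENNReal.ofReal (wt m α (f j) z ^ p) ≤ d * (R : ℝ≥0∞) ^ p :=
      (hdf _ (hf j).1 z).trans (mul_le_mul_right (ENNReal.rpow_le_rpow (hR j) hp.le) _)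
    have h2 := (ENNReal.ofReal_le_iff_le_toReal hKtop).1 h1
    calc wt m α (f j) z = (wt m α (f j) z ^ p) ^ (1 / p) := by
          rw [← Real.rpow_mul (wt_nonneg _ _ _ _), mul_one_div_cancel hp.ne', Real.rpow_one]
      _ ≤ K := Real.rpow_le_rpow (Real.rpow_nonneg (wt_nonneg _ _ _ _) _) h2 (by positivity)
  have hbound : ∀ ρ j z, ‖z‖ ≤ ρ → ‖f j z‖ ≤ K * Real.exp (α / 2 * ρ ^ 2) := by
    intro ρ j z hz
    have h1 : ‖f j z‖ * Real.exp (-(α / 2) * ‖z‖ ^ 2) ≤ K := by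
      refine le_trans ?_ (hwtK j z)
      rw [wt, mul_assoc]
      exact le_mul_of_one_le_left (by positivity) (one_le_pow₀ (by linarith [norm_nonneg z]))
    have h2 : ‖f j z‖ ≤ K * Real.exp (α / 2 * ‖z‖ ^ 2) := by
      have h3 := mul_le_mul_of_nonneg_right h1 (Real.exp_pos (α / 2 * ‖z‖ ^ 2)).le
      rwa [mul_assoc, ← Real.exp_add, neg_mul, neg_add_cancel, Real.exp_zero, mul_one] at h3
    have hK0 : 0 ≤ K := by positivity
    refine h2.trans (mul_le_mul_of_nonneg_left (Real.exp_le_exp.2 ?_) hK0)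
    have := pow_le_pow_left₀ (norm_nonneg z) hz 2
    nlinarith
  obtain ⟨φ, hφ, g, hg, hlim⟩ := exists_subseq_tendsto_differentiable (fun j => (hf j).1)
    (M := fun ρ => K * Real.exp (α / 2 * ρ ^ 2)) hbound
  have hgR : fsNorm n m α p g ≤ R :=
    fsNorm_le_of_tendsto m α hp (fun j => (hf (φ j)).1.continuous) hlim fun j => hR _
  have hgmem : g ∈ fsSpace n m α p := ⟨hg, hgR.trans_lt ENNReal.coe_lt_top⟩
  refine ⟨φ, hφ, wComp u ψ g, hmaps g hgmem, ?_⟩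
  have hdiff : ∀ j, Differentiable ℂ (f (φ j) - g) := fun j => (hf _).1.sub hg
  have hS : ∀ j, fsNorm n m α p (f (φ j) - g)
      ≤ (ENNReal.ofReal (2 ^ p) * ((R : ℝ≥0∞) ^ p + (R : ℝ≥0∞) ^ p)) ^ (1 / p) := by
    intro j
    rw [← ENNReal.rpow_le_rpow_iff hp, ← ENNReal.rpow_mul, one_div_mul_cancel hp.ne',
      ENNReal.rpow_one]
    refine (fsNorm_rpow_le_of_norm_le m α hp (hf (φ j)).1.continuous
      (g := g) fun z => norm_sub_le _ _).trans ?_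
    gcongr
    exact hR _
  have hStop : (ENNReal.ofReal (2 ^ p) * ((R : ℝ≥0∞) ^ p + (R : ℝ≥0∞) ^ p)) ^ (1 / p) ≠ ∞ := by
    have : (R : ℝ≥0∞) ^ p ≠ ∞ := ENNReal.rpow_ne_top_of_nonneg hp.le ENNReal.coe_ne_top
    exact ENNReal.rpow_ne_top_of_nonneg (by positivity)
      (ENNReal.mul_ne_top ENNReal.ofReal_ne_top (ENNReal.add_ne_top.2 ⟨this, this⟩))
  have hzero := tendsto_lintegral_wt_mul n m hn hα hq hqp hBm hBs hdiff hStop hS fun z => by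
    have := (hlim z).sub_const (g z)
    rwa [sub_self] at this
  obtain ⟨c, hc, hcf⟩ := exists_fsNorm_wComp_le n m hα hq
  have hqpow : Tendsto (fun j => fsNorm n m α q (wComp u ψ (f (φ j) - g)) ^ q) atTop (𝓝 0) := by
    refine tendsto_of_tendsto_of_tendsto_of_le_of_le tendsto_const_nhds
      (h := fun j => c * ∫⁻ w, ENNReal.ofReal (wt m α (f (φ j) - g) w ^ q) *
        berezin n m α q u ψ w) ?_ (fun _ => zero_le)
      fun j => hcf u ψ hu.continuous hψ.continuous _ (hdiff j)
    simpa using ENNReal.Tendsto.const_mul hzero (Or.inr hc)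
  have hroot := ((ENNReal.continuous_rpow_const (y := 1 / q)).tendsto 0).comp hqpow
  rw [ENNReal.zero_rpow_of_pos (by positivity)] at hroot
  refine hroot.congr fun j => ?_
  have e : wComp u ψ (f (φ j) - g) = wComp u ψ (f (φ j)) - wComp u ψ g := by
    funext z
    simp [wComp, mul_sub]
  simp only [Function.comp_apply]
  rw [← ENNReal.rpow_mul, mul_one_div_cancel hq.ne', ENNReal.rpow_one, e]

/-! ### Compactness implies boundedness. -/

theorem IsCompactOp.isBoundedOp {n m : ℕ} {α p q : ℝ} (hp : 0 < p) (hq : 0 < q)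
    {u : Cn n → ℂ} {ψ : Cn n → Cn n} (h : IsCompactOp n m α p q u ψ) :
    IsBoundedOp n m α p q u ψ := by
  refine ⟨h.1, ?_⟩
  by_contra! hcon
  choose f hf hfn using fun j : ℕ => hcon (j : ℝ≥0)
  have hfin : ∀ j, fsNorm n m α q (wComp u ψ (f j)) ≠ ∞ := fun j => (h.1 _ (hf j)).2.ne
  have hpos : ∀ j, fsNorm n m α q (wComp u ψ (f j)) ≠ 0 := fun j => (zero_le.trans_lt (hfn j)).ne'
  -- This scaling makes the image norm exactly j, while failure of the bound j keeps the norm of the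
  -- rescaled function at most 1. A convergent subsequence of images would be bounded.
  let t : ℕ → ℝ := fun j => j / (fsNorm n m α q (wComp u ψ (f j))).toReal
  have ht : ∀ j, ENNReal.ofReal ‖(t j : ℂ)‖ = j / fsNorm n m α q (wComp u ψ (f j)) := by
    intro j
    have h1 : 0 ≤ t j := by positivity
    rw [Complex.norm_real, Real.norm_of_nonneg h1,
      ENNReal.ofReal_div_of_pos (ENNReal.toReal_pos (hpos j) (hfin j)),
      ENNReal.ofReal_toReal (hfin j), ENNReal.ofReal_natCast]
  let g : ℕ → Cn n → ℂ := fun j z => t j * f j z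
  have hgn : ∀ j, fsNorm n m α p (g j) ≤ (1 : ℝ≥0) := by
    intro j
    rw [fsNorm_const_mul m α hp, ht, ENNReal.coe_one, mul_comm, ← mul_div_assoc, mul_comm]
    refine ENNReal.div_le_of_le_mul ?_
    rw [one_mul]
    exact (hfn j).le
  have hg : ∀ j, g j ∈ fsSpace n m α p := fun j =>
    ⟨(hf j).1.const_mul _, (hgn j).trans_lt ENNReal.coe_lt_top⟩
  have hTg : ∀ j, fsNorm n m α q (wComp u ψ (g j)) = j := by
    intro j
    have e : wComp u ψ (g j) = fun z => (t j : ℂ) * wComp u ψ (f j) z := by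
      funext z
      simp only [wComp, g]; ring
    rw [e, fsNorm_const_mul m α hq, ht, ENNReal.div_mul_cancel (hpos j) (hfin j)]
  obtain ⟨φ, hφ, k, hk, hlim⟩ := h.2 g hg ⟨1, hgn⟩
  obtain ⟨N, hN⟩ := eventually_atTop.1 (hlim.eventually_le_const (zero_lt_one' ℝ≥0∞))
  let S : ℝ≥0∞ := ENNReal.ofReal (2 ^ q) * (1 + fsNorm n m α q k ^ q)
  have hS : S ≠ ∞ := ENNReal.mul_ne_top ENNReal.ofReal_ne_top
    (ENNReal.add_ne_top.2 ⟨ENNReal.one_ne_top, ENNReal.rpow_ne_top_of_nonneg hq.le hk.2.ne⟩)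
  have hle : ∀ j ≥ N, ((φ j : ℕ) : ℝ≥0∞) ^ q ≤ S := by
    intro j hj
    rw [← hTg (φ j)]
    have hc : Continuous (wComp u ψ (g (φ j)) - k) :=
      (h.1 _ (hg (φ j))).1.continuous.sub hk.1.continuous
    refine (fsNorm_rpow_le_of_norm_le m α hq hc (g := k) fun z => ?_).trans ?_
    · simpa using norm_add_le (wComp u ψ (g (φ j)) z - k z) (k z)
    · refine mul_le_mul_right (add_le_add_left ?_ _) _
      simpa using ENNReal.rpow_le_rpow (hN j hj) hq.le
  have hSroot : S ^ (1 / q) ≠ ∞ := ENNReal.rpow_ne_top_of_nonneg (by positivity) hS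
  obtain ⟨M, hM⟩ := ENNReal.exists_nat_gt hSroot
  have h1 := ENNReal.rpow_le_rpow (hle (max N M) (le_max_left _ _)) (one_div_pos.2 hq).le
  rw [← ENNReal.rpow_mul, mul_one_div_cancel hq.ne', ENNReal.rpow_one] at h1
  have h2 : M ≤ φ (max N M) := (le_max_right N M).trans (hφ.id_le _)
  exact absurd (hM.trans_le ((Nat.cast_le.2 h2).trans h1)) (lt_irrefl _)

/-! ### The lattice and Gaussian sums over it. -/

/-- The index set of the Gaussian integer lattice of `ℂⁿ`. -/
abbrev LatIdx (n : ℕ) : Type := Fin n → ℤ × ℤ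

/-- The lattice point with index `k`. -/
def latPt {n : ℕ} (k : LatIdx n) : Cn n := WithLp.toLp 2 fun j => (⟨(k j).1, (k j).2⟩ : ℂ)

/-- The index of the cell that contains `z`. -/
def latIdx {n : ℕ} (z : Cn n) : LatIdx n := fun j => (⌊(z j).re⌋, ⌊(z j).im⌋)

/-- The half-open unit cube at the lattice point with index `k`. -/
def latCell {n : ℕ} (k : LatIdx n) : Set (Cn n) := latIdx ⁻¹' {k}

theorem measurable_latIdx {n : ℕ} : Measurable (latIdx (n := n)) := by
  refine measurable_pi_iff.2 fun j => ?_
  have hj : Measurable fun z : Cn n => z j := Continuous.measurable (by fun_prop)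
  exact (Int.measurable_floor.comp (Complex.measurable_re.comp hj)).prodMk
    (Int.measurable_floor.comp (Complex.measurable_im.comp hj))

theorem measurableSet_latCell {n : ℕ} (k : LatIdx n) : MeasurableSet (latCell k) :=
  measurable_latIdx (measurableSet_singleton k)

theorem pairwise_disjoint_latCell {n : ℕ} :
    Pairwise (Function.onFun Disjoint (latCell (n := n))) := by
  intro k l hkl
  refine Set.disjoint_left.2 fun z hk hl => hkl ?_
  rw [latCell, Set.mem_preimage, Set.mem_singleton_iff] at hk hl
  rw [← hk, ← hl]

theorem iUnion_latCell {n : ℕ} : ⋃ k, latCell (n := n) k = Set.univ :=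
  Set.eq_univ_of_forall fun z => Set.mem_iUnion.2 ⟨latIdx z, rfl⟩

theorem norm_sub_latPt_sq_le {n : ℕ} {k : LatIdx n} {z : Cn n} (hz : z ∈ latCell k) :
    ‖z - latPt k‖ ^ 2 ≤ 2 * n := by
  have hk : latIdx z = k := hz
  rw [EuclideanSpace.norm_sq_eq]
  have h : ∀ j, ‖(z - latPt k) j‖ ^ 2 ≤ 2 := by
    intro j
    have hre : (k j).1 = ⌊(z j).re⌋ := by rw [← hk]; rfl
    have him : (k j).2 = ⌊(z j).im⌋ := by rw [← hk]; rfl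
    rw [← Complex.normSq_eq_norm_sq, Complex.normSq_apply]
    have e1 : ((z - latPt k) j).re = Int.fract (z j).re := by
      simp [latPt, hre]
    have e2 : ((z - latPt k) j).im = Int.fract (z j).im := by
      simp [latPt, him]
    rw [e1, e2]
    have := Int.fract_nonneg (z j).re
    have := Int.fract_lt_one (z j).re
    have := Int.fract_nonneg (z j).im
    have := Int.fract_lt_one (z j).im
    nlinarith
  calc ∑ j, ‖(z - latPt k) j‖ ^ 2 ≤ ∑ _j : Fin n, (2 : ℝ) := Finset.sum_le_sum fun j _ => h j
    _ = 2 * n := by simp [mul_comm]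

theorem volume_latCell {n : ℕ} (k : LatIdx n) :
    volume (latCell k) = volume (latCell (0 : LatIdx n)) := by
  rw [← measure_preimage_add_right volume (latPt k) (latCell k)]
  congr 1
  ext z
  simp only [latCell, Set.mem_preimage, Set.mem_singleton_iff]
  have : latIdx (z + latPt k) = latIdx z + k := by
    funext j
    simp [latIdx, latPt, Prod.ext_iff]
  rw [this, add_eq_right]

/-- Countably many cells of the same volume cover the space. -/
theorem volume_latCell_ne_zero {n : ℕ} : volume (latCell (0 : LatIdx n)) ≠ 0 := by
  intro h
  have h1 : volume (⋃ k, latCell (n := n) k) = 0 :=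
    measure_iUnion_null fun k => by rw [volume_latCell, h]
  rw [iUnion_latCell] at h1
  exact (NeZero.ne (volume : Measure (Cn n))) (Measure.measure_univ_eq_zero.1 h1)

theorem volume_latCell_ne_top {n : ℕ} : volume (latCell (0 : LatIdx n)) ≠ ∞ := by
  refine ne_top_of_le_ne_top (measure_closedBall_lt_top (x := latPt (0 : LatIdx n))
    (r := √(2 * n))).ne (measure_mono fun z hz => ?_)
  rw [mem_closedBall_iff_norm]
  exact Real.le_sqrt_of_sq_le (norm_sub_latPt_sq_le hz)

theorem lintegral_eq_tsum_latCell {n : ℕ} (F : Cn n → ℝ≥0∞) :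
    ∫⁻ z, F z = ∑' k, ∫⁻ z in latCell k, F z := by
  rw [← lintegral_iUnion measurableSet_latCell pairwise_disjoint_latCell, iUnion_latCell,
    Measure.restrict_univ]

/-- Halving the exponent allows the centre to move a bounded distance, since |w-y|² ≤ 2|w-x|² + 2D.
-/
theorem gauss_sub_le {n : ℕ} {b D : ℝ} (hb : 0 ≤ b) {x y w : Cn n} (h : ‖x - y‖ ^ 2 ≤ D) :
    gauss b (w - x) ≤ ENNReal.ofReal (Real.exp (b * D)) * gauss (b / 2) (w - y) := by
  rw [gauss, gauss, ← ENNReal.ofReal_mul (Real.exp_pos _).le, ← Real.exp_add]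
  refine ENNReal.ofReal_le_ofReal (Real.exp_le_exp.2 ?_)
  have h1 : ‖w - y‖ ≤ ‖w - x‖ + ‖x - y‖ := norm_sub_le_norm_sub_add_norm_sub w x y
  have h2 : ‖w - y‖ ^ 2 ≤ 2 * ‖w - x‖ ^ 2 + 2 * D := by
    have := pow_le_pow_left₀ (norm_nonneg _) h1 2
    nlinarith [sq_nonneg (‖w - x‖ - ‖x - y‖)]
  nlinarith

theorem lintegral_gauss_sub {n : ℕ} (b : ℝ) (x : Cn n) :
    ∫⁻ w, gauss b (w - x) = ∫⁻ w : Cn n, gauss b w :=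
  lintegral_sub_right_eq_self (gauss b) x

theorem gauss_sub_comm {n : ℕ} (b : ℝ) (x y : Cn n) : gauss b (x - y) = gauss b (y - x) := by
  rw [gauss, gauss, norm_sub_rev]

/-- Gaussian sums over the lattice are bounded. -/
theorem exists_tsum_gauss_le (n : ℕ) {b : ℝ} (hb : 0 < b) :
    ∃ C : ℝ≥0∞, C ≠ ∞ ∧ ∀ z : Cn n, ∑' k : LatIdx n, gauss b (z - latPt k) ≤ C := by
  let V := volume (latCell (0 : LatIdx n))
  refine ⟨V⁻¹ * (ENNReal.ofReal (Real.exp (b * (2 * n))) * ∫⁻ w : Cn n, gauss (b / 2) w),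
    ENNReal.mul_ne_top (ENNReal.inv_ne_top.2 volume_latCell_ne_zero) (ENNReal.mul_ne_top
      ENNReal.ofReal_ne_top (lintegral_gauss_ne_top (half_pos hb))), fun z => ?_⟩
  -- Each term times the cell volume is at most a multiple of the integral of a wider Gaussian over
  -- its cell.
  rw [← ENNReal.div_eq_inv_mul, ENNReal.le_div_iff_mul_le (Or.inl volume_latCell_ne_zero)
    (Or.inl volume_latCell_ne_top), ← lintegral_gauss_sub (b / 2) z,
    ← lintegral_const_mul' _ _ ENNReal.ofReal_ne_top, lintegral_eq_tsum_latCell,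
    ← ENNReal.tsum_mul_right]
  refine ENNReal.tsum_le_tsum fun k => ?_
  rw [← volume_latCell k, ← setLIntegral_const]
  refine setLIntegral_mono' (measurableSet_latCell k) fun w hw => ?_
  rw [gauss_sub_comm _ w z]
  refine gauss_sub_le hb.le ?_
  rw [norm_sub_rev]
  exact norm_sub_latPt_sq_le hw

/-- Subadditivity of t ↦ t^p; it serves the range p ≤ 1 of Gaussian synthesis. -/
theorem tsum_rpow_le_tsum_rpow {ι : Type*} {p : ℝ} (hp : 0 < p) (hp1 : p ≤ 1) (x : ι → ℝ≥0∞) :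
    (∑' k, x k) ^ p ≤ ∑' k, x k ^ p := by
  classical
  have hfin : ∀ S : Finset ι, (∑ k ∈ S, x k) ^ p ≤ ∑ k ∈ S, x k ^ p := by
    intro S
    induction S using Finset.induction_on with
    | empty => simp [hp]
    | insert a S ha ih =>
      rw [Finset.sum_insert ha, Finset.sum_insert ha]
      exact (ENNReal.rpow_add_le_add_rpow _ _ hp.le hp1).trans (add_le_add_right ih _)
  have h : ∑' k, x k ≤ (∑' k, x k ^ p) ^ (1 / p) := by
    rw [ENNReal.tsum_eq_iSup_sum]
    refine iSup_le fun S => ?_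
    rw [← ENNReal.rpow_le_rpow_iff hp, ← ENNReal.rpow_mul, one_div_mul_cancel hp.ne',
      ENNReal.rpow_one]
    exact (hfin S).trans (ENNReal.sum_le_tsum S)
  have h2 := ENNReal.rpow_le_rpow h hp.le
  rwa [← ENNReal.rpow_mul, one_div_mul_cancel hp.ne', ENNReal.rpow_one] at h2

/-- Hölder for the splitting a g = (a g^{1/p}) g^{1/p'}; it serves the range p > 1, where the sums
of `g` are bounded. -/
theorem tsum_mul_rpow_le {ι : Type*} {p : ℝ} (hp : 1 < p) (a g : ι → ℝ≥0∞) :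
    (∑' k, a k * g k) ^ p ≤ (∑' k, a k ^ p * g k) * (∑' k, g k) ^ (p - 1) := by
  let _ : MeasurableSpace ι := ⊤
  have hp0 : 0 < p := zero_lt_one.trans hp
  have hpq := Real.HolderConjugate.conjExponent hp
  set p' := p.conjExponent with hp'
  have hp'0 : 0 < p' := hpq.symm.pos
  have hinv : 1 / p + 1 / p' = 1 := by simpa using hpq.inv_add_inv_eq_one
  have h := ENNReal.lintegral_mul_le_Lp_mul_Lq (Measure.count : Measure ι) hpq
    (f := fun k => a k * g k ^ (1 / p)) (g := fun k => g k ^ (1 / p'))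
    measurable_from_top.aemeasurable measurable_from_top.aemeasurable
  simp only [lintegral_count, Pi.mul_apply] at h
  have e1 : ∀ k, a k * g k ^ (1 / p) * g k ^ (1 / p') = a k * g k := by
    intro k
    rw [mul_assoc, ← ENNReal.rpow_add_of_nonneg _ _ (by positivity) (by positivity), hinv,
      ENNReal.rpow_one]
  have e2 : ∀ k, (a k * g k ^ (1 / p)) ^ p = a k ^ p * g k := by
    intro k
    rw [ENNReal.mul_rpow_of_nonneg _ _ hp0.le, ← ENNReal.rpow_mul, one_div_mul_cancel hp0.ne',
      ENNReal.rpow_one]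
  have e3 : ∀ k, (g k ^ (1 / p')) ^ p' = g k := by
    intro k
    rw [← ENNReal.rpow_mul, one_div_mul_cancel hp'0.ne', ENNReal.rpow_one]
  simp only [e1, e2, e3] at h
  refine (ENNReal.rpow_le_rpow h hp0.le).trans (le_of_eq ?_)
  rw [ENNReal.mul_rpow_of_nonneg _ _ hp0.le, ← ENNReal.rpow_mul, one_div_mul_cancel hp0.ne',
    ENNReal.rpow_one, ← ENNReal.rpow_mul]
  congr 2
  have : 1 / p' = 1 - 1 / p := by linarith
  rw [this]
  field_simp

theorem gauss_rpow {n : ℕ} (b p : ℝ) (z : Cn n) : gauss b z ^ p = gauss (b * p) z := by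
  rw [gauss, gauss, ENNReal.ofReal_rpow_of_pos (Real.exp_pos _), ← Real.exp_mul]
  ring_nf

/-- Gaussian synthesis over the lattice is bounded from `ℓ^p` to `L^p`, for every `p > 0`. -/
theorem exists_lintegral_tsum_gauss_rpow_le (n : ℕ) {b p : ℝ} (hb : 0 < b) (hp : 0 < p) :
    ∃ C : ℝ≥0∞, C ≠ ∞ ∧ ∀ a : LatIdx n → ℝ≥0∞,
      ∫⁻ z, (∑' k, a k * gauss b (z - latPt k)) ^ p ≤ C * ∑' k, a k ^ p := by
  have hm : ∀ (c : ℝ) (k : LatIdx n), Measurable fun z => gauss c (z - latPt k) := fun c k =>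
    (measurable_gauss c).comp (measurable_id.sub_const _)
  rcases le_or_gt p 1 with hp1 | hp1
  · refine ⟨∫⁻ w : Cn n, gauss (b * p) w, lintegral_gauss_ne_top (by positivity), fun a => ?_⟩
    calc ∫⁻ z, (∑' k, a k * gauss b (z - latPt k)) ^ p
        ≤ ∫⁻ z, ∑' k, a k ^ p * gauss (b * p) (z - latPt k) := by
          refine lintegral_mono fun z => (tsum_rpow_le_tsum_rpow hp hp1 _).trans (le_of_eq ?_)
          refine tsum_congr fun k => ?_
          rw [ENNReal.mul_rpow_of_nonneg _ _ hp.le, gauss_rpow]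
      _ = ∑' k, a k ^ p * ∫⁻ w : Cn n, gauss (b * p) w := by
          rw [lintegral_tsum fun k => ((hm _ k).const_mul _).aemeasurable]
          refine tsum_congr fun k => ?_
          rw [lintegral_const_mul _ (hm _ k), lintegral_gauss_sub]
      _ = _ := by rw [ENNReal.tsum_mul_right, mul_comm]
  · obtain ⟨C, hC, hCb⟩ := exists_tsum_gauss_le n hb
    refine ⟨(∫⁻ w : Cn n, gauss b w) * C ^ (p - 1), ENNReal.mul_ne_top (lintegral_gauss_ne_top hb)
      (ENNReal.rpow_ne_top_of_nonneg (by linarith) hC), fun a => ?_⟩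
    calc ∫⁻ z, (∑' k, a k * gauss b (z - latPt k)) ^ p
        ≤ ∫⁻ z, (∑' k, a k ^ p * gauss b (z - latPt k)) * C ^ (p - 1) := by
          refine lintegral_mono fun z => (tsum_mul_rpow_le hp1 _ _).trans ?_
          exact mul_le_mul_right (ENNReal.rpow_le_rpow (hCb z) (by linarith)) _
      _ = (∑' k, a k ^ p * ∫⁻ w : Cn n, gauss b w) * C ^ (p - 1) := by
          rw [lintegral_mul_const' _ _ (ENNReal.rpow_ne_top_of_nonneg (by linarith) hC),
            lintegral_tsum fun k => ((hm _ k).const_mul _).aemeasurable]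
          congr 1
          refine tsum_congr fun k => ?_
          rw [lintegral_const_mul _ (hm _ k), lintegral_gauss_sub]
      _ = _ := by rw [ENNReal.tsum_mul_right]; ring

/-! ### Kernel test functions on the lattice. -/

/-- The test function `(1+|w_k|)^{-m} k_{w_k}` at the lattice point `w_k`. -/
def latKern {n : ℕ} (m : ℕ) (α : ℝ) (k : LatIdx n) (z : Cn n) : ℂ :=
  (((1 + ‖latPt k‖) ^ m : ℝ) : ℂ)⁻¹ * kern α (latPt k) z

theorem differentiable_latKern {n : ℕ} (m : ℕ) (α : ℝ) (k : LatIdx n) :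
    Differentiable ℂ (latKern m α k) := by
  unfold latKern kern
  refine Differentiable.const_mul (Differentiable.cexp (Differentiable.sub_const
    (Differentiable.const_mul ?_ _) _)) _
  exact (innerSL ℂ (latPt k)).differentiable

theorem wt_latKern {n : ℕ} (m : ℕ) (α : ℝ) (k : LatIdx n) (z : Cn n) :
    wt m α (latKern m α k) z
      = ((1 + ‖z‖) / (1 + ‖latPt k‖)) ^ m * Real.exp (-(α / 2) * ‖z - latPt k‖ ^ 2) := by
  have h0 : (0 : ℝ) < (1 + ‖latPt k‖) ^ m := by positivity
  rw [wt, latKern, norm_mul, norm_inv, Complex.norm_real, Real.norm_of_nonneg h0.le, norm_kern,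
    div_pow]
  have : Real.exp (-(α / 2) * ‖z - latPt k‖ ^ 2)
      = Real.exp (α / 2 * (‖z‖ ^ 2 - ‖z - latPt k‖ ^ 2)) * Real.exp (-(α / 2) * ‖z‖ ^ 2) := by
    rw [← Real.exp_add]; congr 1; ring
  rw [this]
  field_simp

/-- Half of the Gaussian absorbs the polynomial: (1+t)^m ≤ m! e^{1+t}, and t ≤ αt²/4 + 1/α by
completing the square. -/
theorem one_add_pow_mul_exp_le (m : ℕ) {α : ℝ} (hα : 0 < α) {t : ℝ} (ht : 0 ≤ t) :
    (1 + t) ^ m * Real.exp (-(α / 2) * t ^ 2)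
      ≤ (m.factorial * Real.exp (1 + 1 / α)) * Real.exp (-(α / 4) * t ^ 2) := by
  have h1 : (1 + t) ^ m ≤ m.factorial * Real.exp (1 + t) := by
    have h := Real.pow_div_factorial_le_exp (1 + t) (by linarith) m
    rwa [div_le_iff₀ (by positivity), mul_comm] at h
  have h2 : t ≤ α / 4 * t ^ 2 + 1 / α := by
    have : α / 4 * t ^ 2 + 1 / α - t = α * (t / 2 - 1 / α) ^ 2 := by field_simp; ring
    have h3 : 0 ≤ α * (t / 2 - 1 / α) ^ 2 := by positivity
    linarith
  calc (1 + t) ^ m * Real.exp (-(α / 2) * t ^ 2)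
      ≤ (m.factorial * Real.exp (1 + t)) * Real.exp (-(α / 2) * t ^ 2) := by gcongr
    _ = m.factorial * Real.exp (1 + t + -(α / 2) * t ^ 2) := by rw [Real.exp_add (1 + t)]; ring
    _ ≤ m.factorial * Real.exp (1 + 1 / α + -(α / 4) * t ^ 2) := by
        refine mul_le_mul_of_nonneg_left (Real.exp_le_exp.2 ?_) (by positivity)
        linarith
    _ = _ := by rw [Real.exp_add]; ring

theorem wt_latKern_le {n : ℕ} (m : ℕ) {α : ℝ} (hα : 0 < α) (k : LatIdx n) (z : Cn n) :
    wt m α (latKern m α k) z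
      ≤ (m.factorial * Real.exp (1 + 1 / α)) * Real.exp (-(α / 4) * ‖z - latPt k‖ ^ 2) := by
  rw [wt_latKern]
  refine le_trans ?_ (one_add_pow_mul_exp_le m hα (norm_nonneg (z - latPt k)))
  refine mul_le_mul_of_nonneg_right (pow_le_pow_left₀ (by positivity) ?_ _) (by positivity)
  rw [div_le_iff₀ (by positivity)]
  have := norm_le_norm_sub_add z (latPt k)
  nlinarith [mul_nonneg (norm_nonneg (z - latPt k)) (norm_nonneg (latPt k))]

/-- On its own cell, of bounded diameter, a test function has weighted modulus bounded below
uniformly in k. -/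
theorem exists_le_wt_latKern (n m : ℕ) {α : ℝ} (hα : 0 < α) :
    ∃ c : ℝ, 0 < c ∧ ∀ (k : LatIdx n), ∀ z ∈ latCell k, c ≤ wt m α (latKern m α k) z := by
  refine ⟨((1 + √(2 * n))⁻¹) ^ m * Real.exp (-(α / 2) * (2 * n)), by positivity, fun k z hz => ?_⟩
  have hD := norm_sub_latPt_sq_le hz
  have hD' : ‖z - latPt k‖ ≤ √(2 * n) := Real.le_sqrt_of_sq_le hD
  rw [wt_latKern]
  refine mul_le_mul (pow_le_pow_left₀ (by positivity) ?_ _) (Real.exp_le_exp.2 ?_) (by positivity)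
    (by positivity)
  · rw [inv_eq_one_div, div_le_div_iff₀ (by positivity) (by positivity)]
    have h1 : ‖latPt k‖ ≤ ‖z‖ + ‖z - latPt k‖ := by
      rw [norm_sub_rev]
      have := norm_le_norm_sub_add (latPt k) z
      linarith
    nlinarith [mul_nonneg (norm_nonneg z) (Real.sqrt_nonneg (2 * n : ℝ))]
  · nlinarith

/-- Finite combinations of the lattice test functions are bounded by the `ℓ^p` norm of the
coefficients. -/
theorem exists_fsNorm_sum_latKern_le (n m : ℕ) {α p : ℝ} (hα : 0 < α) (hp : 0 < p) :
    ∃ C : ℝ≥0∞, C ≠ ∞ ∧ ∀ (S : Finset (LatIdx n)) (a : LatIdx n → ℝ≥0),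
      fsNorm n m α p (fun z => ∑ k ∈ S, ((a k : ℝ) : ℂ) * latKern m α k z) ^ p
        ≤ C * ∑ k ∈ S, (a k : ℝ≥0∞) ^ p := by
  obtain ⟨d, hd, hdf⟩ := exists_fsNorm_rpow_le_lintegral_wt n m α hp
  obtain ⟨C, hC, hCf⟩ := exists_lintegral_tsum_gauss_rpow_le n (b := α / 4) (by positivity) hp
  let M : ℝ := m.factorial * Real.exp (1 + 1 / α)
  have hM : 0 ≤ M := by positivity
  refine ⟨d * (ENNReal.ofReal (M ^ p) * C), ENNReal.mul_ne_top hd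
    (ENNReal.mul_ne_top ENNReal.ofReal_ne_top hC), fun S a => (hdf _).trans ?_⟩
  classical
  -- Extension by zero, so that the synthesis bound over the whole lattice applies.
  let a' : LatIdx n → ℝ≥0∞ := fun k => if k ∈ S then (a k : ℝ≥0∞) else 0
  have hsum : ∑' k, a' k ^ p = ∑ k ∈ S, (a k : ℝ≥0∞) ^ p := by
    rw [tsum_eq_sum (s := S) fun k hk => by simp [a', hk, hp]]
    exact Finset.sum_congr rfl fun k hk => by simp [a', hk]
  rw [mul_assoc, mul_assoc, ← hsum]
  refine mul_le_mul_right ?_ _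
  refine le_trans ?_ (mul_le_mul_right (hCf a') _)
  rw [← lintegral_const_mul' _ _ ENNReal.ofReal_ne_top]
  refine lintegral_mono fun z => ?_
  dsimp only
  have htsum : ∑' k, a' k * gauss (α / 4) (z - latPt k)
      = ENNReal.ofReal (∑ k ∈ S, (a k : ℝ) * Real.exp (-(α / 4) * ‖z - latPt k‖ ^ 2)) := by
    rw [tsum_eq_sum (s := S) fun k hk => by simp [a', hk],
      ENNReal.ofReal_sum_of_nonneg fun k _ => by positivity]
    refine Finset.sum_congr rfl fun k hk => ?_
    rw [ENNReal.ofReal_mul (by positivity), ENNReal.ofReal_coe_nnreal]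
    simp [a', hk, gauss]
  rw [htsum, ENNReal.ofReal_rpow_of_nonneg (Finset.sum_nonneg fun k _ => by positivity) hp.le,
    ← ENNReal.ofReal_mul (by positivity), ← Real.mul_rpow hM
      (Finset.sum_nonneg fun k _ => by positivity)]
  refine ENNReal.ofReal_le_ofReal (Real.rpow_le_rpow (wt_nonneg _ _ _ _) ?_ hp.le)
  calc wt m α (fun z => ∑ k ∈ S, ((a k : ℝ) : ℂ) * latKern m α k z) z
      ≤ (1 + ‖z‖) ^ m * (∑ k ∈ S, (a k : ℝ) * ‖latKern m α k z‖) *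
          Real.exp (-(α / 2) * ‖z‖ ^ 2) := by
        refine mul_le_mul_of_nonneg_right (mul_le_mul_of_nonneg_left ?_ (by positivity))
          (by positivity)
        refine (norm_sum_le _ _).trans (le_of_eq (Finset.sum_congr rfl fun k _ => ?_))
        rw [norm_mul, Complex.norm_real, Real.norm_of_nonneg (NNReal.coe_nonneg _)]
    _ = ∑ k ∈ S, (a k : ℝ) * wt m α (latKern m α k) z := by
        rw [Finset.mul_sum, Finset.sum_mul]
        refine Finset.sum_congr rfl fun k _ => ?_
        rw [wt]; ring
    _ ≤ ∑ k ∈ S, (a k : ℝ) * (M * Real.exp (-(α / 4) * ‖z - latPt k‖ ^ 2)) :=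
        Finset.sum_le_sum fun k _ => mul_le_mul_of_nonneg_left (wt_latKern_le m hα k z) (a k).2
    _ = _ := by
        rw [Finset.mul_sum]
        exact Finset.sum_congr rfl fun k _ => by ring

/-! ### The lower bound by averaging over sub-sums. -/

/-- Averaging over all sub-sums of a finite sum controls each of its terms. -/
theorem card_mul_norm_rpow_le_sum_powerset {ι : Type*} [DecidableEq ι] (S : Finset ι) (x : ι → ℂ)
    {q : ℝ} (hq : 0 < q) {j : ι} (hj : j ∈ S) :
    (2 ^ S.card / 2 ^ (q + 1)) * ‖x j‖ ^ q ≤ ∑ T ∈ S.powerset, ‖∑ k ∈ T, x k‖ ^ q := by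
  -- Pair each T not containing j with T ∪ {j}: the two sums differ by x_j. There are 2^{|S|-1}
  -- pairs, each contributing at least |x_j|^q / 2^q.
  rw [← Finset.insert_erase hj, Finset.sum_powerset_insert (Finset.notMem_erase j S),
    ← Finset.sum_add_distrib, Finset.card_insert_of_notMem (Finset.notMem_erase j S)]
  have hterm : ∀ T ∈ (S.erase j).powerset, ‖x j‖ ^ q / 2 ^ q
      ≤ ‖∑ k ∈ T, x k‖ ^ q + ‖∑ k ∈ insert j T, x k‖ ^ q := by
    intro T hT
    have hjT : j ∉ T := fun h => Finset.notMem_erase j S (Finset.mem_powerset.1 hT h)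
    rw [Finset.sum_insert hjT, div_le_iff₀ (by positivity), mul_comm, add_comm]
    refine rpow_le_of_le_add hq (norm_nonneg _) (norm_nonneg _) (norm_nonneg _) ?_
    simpa using norm_sub_le (x j + ∑ k ∈ T, x k) (∑ k ∈ T, x k)
  refine le_trans (le_of_eq ?_) (Finset.card_nsmul_le_sum _ _ _ hterm)
  rw [Finset.card_powerset, nsmul_eq_mul, Real.rpow_add_one two_ne_zero, pow_succ]
  push_cast
  field_simp

/-- The finite combination of the lattice test functions with coefficients `a`. -/
def latSum {n : ℕ} (m : ℕ) (α : ℝ) (a : LatIdx n → ℝ≥0) (T : Finset (LatIdx n)) (z : Cn n) : ℂ :=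
  ∑ k ∈ T, ((a k : ℝ) : ℂ) * latKern m α k z

theorem differentiable_latSum {n : ℕ} (m : ℕ) (α : ℝ) (a : LatIdx n → ℝ≥0)
    (T : Finset (LatIdx n)) : Differentiable ℂ (latSum m α a T) := by
  unfold latSum
  exact Differentiable.fun_sum fun k _ => (differentiable_latKern m α k).const_mul _

theorem le_sum_powerset_wt_latSum {n : ℕ} (m : ℕ) {α q c : ℝ} (hq : 0 < q) (hc : 0 < c)
    (a : LatIdx n → ℝ≥0) {S : Finset (LatIdx n)} {j : LatIdx n} (hj : j ∈ S) {w : Cn n}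
    (hw : c ≤ wt m α (latKern m α j) w) :
    2 ^ S.card * (c ^ q / 2 ^ (q + 1)) * (a j : ℝ) ^ q
      ≤ ∑ T ∈ S.powerset, wt m α (latSum m α a T) w ^ q := by
  let W : ℝ := (1 + ‖w‖) ^ m * Real.exp (-(α / 2) * ‖w‖ ^ 2)
  have hW : 0 ≤ W := by positivity
  have hwt : ∀ f : Cn n → ℂ, wt m α f w ^ q = W ^ q * ‖f w‖ ^ q := by
    intro f
    rw [← Real.mul_rpow hW (norm_nonneg _), wt]
    congr 1
    simp only [W]; ring
  have h := card_mul_norm_rpow_le_sum_powerset S (fun k => ((a k : ℝ) : ℂ) * latKern m α k w) hq hj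
  rw [norm_mul, Complex.norm_real, Real.norm_of_nonneg (NNReal.coe_nonneg _),
    Real.mul_rpow (NNReal.coe_nonneg _) (norm_nonneg _)] at h
  simp_rw [hwt, ← Finset.mul_sum]
  refine le_trans ?_ (mul_le_mul_of_nonneg_left h (Real.rpow_nonneg hW q))
  have h1 : c ^ q ≤ W ^ q * ‖latKern m α j w‖ ^ q := by
    rw [← hwt]
    exact Real.rpow_le_rpow hc.le hw hq.le
  calc 2 ^ S.card * (c ^ q / 2 ^ (q + 1)) * (a j : ℝ) ^ q
      = (2 ^ S.card / 2 ^ (q + 1) * (a j : ℝ) ^ q) * c ^ q := by ring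
    _ ≤ (2 ^ S.card / 2 ^ (q + 1) * (a j : ℝ) ^ q) * (W ^ q * ‖latKern m α j w‖ ^ q) :=
        mul_le_mul_of_nonneg_left h1 (by positivity)
    _ = _ := by ring

/-- The discretized necessary condition for the boundedness of `uC_ψ`. -/
theorem exists_sum_latCell_le (n m : ℕ) {α p q : ℝ} (hn : 1 ≤ n) (hα : 0 < α) (hq : 0 < q)
    (hp : 0 < p) :
    ∃ C : ℝ≥0∞, C ≠ ∞ ∧ ∀ (u : Cn n → ℂ) (ψ : Cn n → Cn n), Continuous u → Continuous ψ →
      ∀ K : ℝ≥0∞, (∀ f ∈ fsSpace n m α p,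
        fsNorm n m α q (wComp u ψ f) ≤ K * fsNorm n m α p f) →
      ∀ (S : Finset (LatIdx n)) (a : LatIdx n → ℝ≥0),
        ∑ k ∈ S, (a k : ℝ≥0∞) ^ q * ∫⁻ z in ψ ⁻¹' latCell k, pullDens m α q u ψ z
          ≤ C * K ^ q * (∑ k ∈ S, (a k : ℝ≥0∞) ^ p) ^ (q / p) := by
  obtain ⟨c, hc, hcw⟩ := exists_le_wt_latKern n m hα
  obtain ⟨D, hD, hDf⟩ := exists_fsNorm_sum_latKern_le n m hα hp
  let κ := ENNReal.ofReal (normConst n m α q)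
  have hκ0 : κ ≠ 0 := by simpa [κ] using normConst_pos (n := n) m hn hα hq
  let e := ENNReal.ofReal (c ^ q / 2 ^ (q + 1))
  have he0 : e ≠ 0 := by simp only [e, ne_eq, ENNReal.ofReal_eq_zero, not_le]; positivity
  have hqp : 0 ≤ q / p := by positivity
  refine ⟨e⁻¹ * (κ⁻¹ * D ^ (q / p)), ENNReal.mul_ne_top (ENNReal.inv_ne_top.2 he0)
    (ENNReal.mul_ne_top (ENNReal.inv_ne_top.2 hκ0) (ENNReal.rpow_ne_top_of_nonneg hqp hD)),
    fun u ψ hu hψ K hK S a => ?_⟩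
  have hpm := measurable_pullDens m α q hu hψ
  have hcell : ∀ k, MeasurableSet (ψ ⁻¹' latCell k) := fun k =>
    hψ.measurable (measurableSet_latCell k)
  -- The cells are disjoint, so at most one term on the left is nonzero at z, and the single-term
  -- bound suffices.
  have hpt : ∀ z, ∑ k ∈ S, (2 ^ S.card * e) * (a k : ℝ≥0∞) ^ q *
      (ψ ⁻¹' latCell k).indicator (pullDens m α q u ψ) z
      ≤ ∑ T ∈ S.powerset, fsDens m α q (wComp u ψ (latSum m α a T)) z := by
    intro z
    by_cases hj : latIdx (ψ z) ∈ S
    · rw [Finset.sum_eq_single_of_mem _ hj fun k _ hk => by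
        rw [Set.indicator_of_notMem, mul_zero]
        exact fun h => hk (Eq.symm h)]
      have hz : z ∈ ψ ⁻¹' latCell (latIdx (ψ z)) := rfl
      rw [Set.indicator_of_mem hz]
      simp_rw [fsDens_wComp]
      rw [← Finset.sum_mul]
      refine mul_le_mul_left ?_ _
      have h := ENNReal.ofReal_le_ofReal (le_sum_powerset_wt_latSum m hq hc a hj (hcw _ _ hz))
      rw [ENNReal.ofReal_sum_of_nonneg fun T _ => Real.rpow_nonneg (wt_nonneg _ _ _ _) _,
        ENNReal.ofReal_mul (by positivity), ENNReal.ofReal_mul (by positivity),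
        ← ENNReal.ofReal_rpow_of_nonneg (NNReal.coe_nonneg _) hq.le,
        ENNReal.ofReal_coe_nnreal] at h
      rw [ENNReal.ofReal_pow zero_le_two, ENNReal.ofReal_ofNat] at h
      exact h
    · rw [Finset.sum_eq_zero fun k hk => by
        rw [Set.indicator_of_notMem, mul_zero]
        intro h
        exact hj (by rwa [show latIdx (ψ z) = k from h])]
      exact zero_le
  have hint : (2 ^ S.card * e) *
      ∑ k ∈ S, (a k : ℝ≥0∞) ^ q * ∫⁻ z in ψ ⁻¹' latCell k, pullDens m α q u ψ z
      ≤ ∑ T ∈ S.powerset, ∫⁻ z, fsDens m α q (wComp u ψ (latSum m α a T)) z := by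
    have hdm : ∀ T, Measurable (fsDens m α q (wComp u ψ (latSum m α a T))) := fun T =>
      measurable_fsDens m α q (hu.mul ((differentiable_latSum m α a T).continuous.comp hψ))
    rw [← lintegral_finsetSum _ fun T _ => hdm T]
    refine le_trans (le_of_eq ?_) (lintegral_mono hpt)
    rw [lintegral_finsetSum _ fun k _ => (hpm.indicator (hcell k)).const_mul _, Finset.mul_sum]
    refine Finset.sum_congr rfl fun k _ => ?_
    rw [lintegral_const_mul _ (hpm.indicator (hcell k)), lintegral_indicator (hcell k)]
    ring
  have hbd : ∀ T ∈ S.powerset, ∫⁻ z, fsDens m α q (wComp u ψ (latSum m α a T)) z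
      ≤ κ⁻¹ * (K ^ q * (D ^ (q / p) * (∑ k ∈ S, (a k : ℝ≥0∞) ^ p) ^ (q / p))) := by
    intro T hT
    have h1 : fsNorm n m α p (latSum m α a T) ^ p ≤ D * ∑ k ∈ S, (a k : ℝ≥0∞) ^ p :=
      (hDf T a).trans (mul_le_mul_right
        (Finset.sum_le_sum_of_subset (Finset.mem_powerset.1 hT)) _)
    have h2 : fsNorm n m α p (latSum m α a T) ^ q
        ≤ D ^ (q / p) * (∑ k ∈ S, (a k : ℝ≥0∞) ^ p) ^ (q / p) := by
      rw [← ENNReal.mul_rpow_of_nonneg _ _ hqp]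
      refine le_trans (le_of_eq ?_) (ENNReal.rpow_le_rpow h1 hqp)
      rw [← ENNReal.rpow_mul, mul_div_cancel₀ _ hp.ne']
    have hmem : latSum m α a T ∈ fsSpace n m α p := by
      refine ⟨differentiable_latSum m α a T, ?_⟩
      have h3 : D * ∑ k ∈ S, (a k : ℝ≥0∞) ^ p < ∞ :=
        ENNReal.mul_lt_top hD.lt_top (ENNReal.sum_lt_top.2 fun k _ =>
          ENNReal.rpow_lt_top_of_nonneg hp.le ENNReal.coe_ne_top)
      by_contra htop
      rw [not_lt, top_le_iff] at htop
      rw [htop, ENNReal.top_rpow_of_pos hp] at h1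
      exact h3.not_ge h1
    have h4 := ENNReal.rpow_le_rpow (hK _ hmem) hq.le
    rw [fsNorm_rpow m α hq, ENNReal.mul_rpow_of_nonneg _ _ hq.le] at h4
    rw [← ENNReal.div_eq_inv_mul, ENNReal.le_div_iff_mul_le (Or.inl hκ0)
      (Or.inl ENNReal.ofReal_ne_top), mul_comm]
    exact h4.trans (mul_le_mul_right h2 _)
  -- There are 2^{|S|} subsets, each with the same bound; the factor cancels and the constant does
  -- not depend on S.
  have hfin := hint.trans (Finset.sum_le_card_nsmul _ _ _ hbd)
  rw [Finset.card_powerset, nsmul_eq_mul, mul_assoc, Nat.cast_pow, Nat.cast_ofNat,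
    ENNReal.mul_le_mul_iff_right (by simp) (by simp)] at hfin
  rw [mul_comm e, ← ENNReal.le_div_iff_mul_le (Or.inl he0) (Or.inl ENNReal.ofReal_ne_top),
    ENNReal.div_eq_inv_mul] at hfin
  refine hfin.trans (le_of_eq ?_)
  ring

theorem exists_tsum_latCell_rpow_le (n m : ℕ) {α p q : ℝ} (hn : 1 ≤ n) (hα : 0 < α) (hq : 0 < q)
    (hqp : q < p) :
    ∃ C : ℝ≥0∞, C ≠ ∞ ∧ ∀ (u : Cn n → ℂ) (ψ : Cn n → Cn n), Continuous u → Continuous ψ →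
      ∀ K : ℝ≥0∞, K ≠ ∞ → (∀ f ∈ fsSpace n m α p,
        fsNorm n m α q (wComp u ψ f) ≤ K * fsNorm n m α p f) →
        ∑' k, (∫⁻ z in ψ ⁻¹' latCell k, pullDens m α q u ψ z) ^ (p / (p - q))
          ≤ (C * K ^ q) ^ (p / (p - q)) := by
  have hp : 0 < p := hq.trans hqp
  have hpq : 0 < p - q := sub_pos.2 hqp
  obtain ⟨C, hC, hCs⟩ := exists_sum_latCell_le n m hn hα hq hp
  refine ⟨C, hC, fun u ψ hu hψ K hKtop hK => ?_⟩
  set ν : LatIdx n → ℝ≥0∞ := fun k => ∫⁻ z in ψ ⁻¹' latCell k, pullDens m α q u ψ z with hν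
  have hA : C * K ^ q ≠ ∞ := ENNReal.mul_ne_top hC (ENNReal.rpow_ne_top_of_nonneg hq.le hKtop)
  -- Testing on a single lattice function gives finite cell masses, which the choice of coefficients
  -- below requires.
  have hνtop : ∀ k, ν k ≠ ∞ := by
    intro k
    have h := hCs u ψ hu hψ K hK {k} (fun _ => 1)
    simp only [Finset.sum_singleton, ENNReal.coe_one, ENNReal.one_rpow, one_mul, mul_one] at h
    exact ne_top_of_le_ne_top hA h
  rw [ENNReal.tsum_eq_iSup_sum]
  refine iSup_le fun S => ?_
  -- The extremal choice in the duality: a^q ν = a^p = ν^{p/(p-q)}. The inequality becomes X ≤ C K^q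
  -- X^{q/p}, and X is finite because S is.
  let a : LatIdx n → ℝ≥0 := fun k => (ν k).toNNReal ^ (1 / (p - q))
  have ha : ∀ k, (a k : ℝ≥0∞) = ν k ^ (1 / (p - q)) := by
    intro k
    rw [ENNReal.coe_rpow_of_nonneg _ (by positivity), ENNReal.coe_toNNReal (hνtop k)]
  have h := hCs u ψ hu hψ K hK S a
  have e1 : ∀ k, (a k : ℝ≥0∞) ^ q * ν k = ν k ^ (p / (p - q)) := by
    intro k
    rw [ha, ← ENNReal.rpow_mul]
    nth_rewrite 2 [← ENNReal.rpow_one (ν k)]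
    rw [← ENNReal.rpow_add_of_nonneg _ _ (by positivity) zero_le_one]
    congr 1
    field_simp
    ring
  have e2 : ∀ k, (a k : ℝ≥0∞) ^ p = ν k ^ (p / (p - q)) := by
    intro k
    rw [ha, ← ENNReal.rpow_mul]
    congr 1
    field_simp
  change ∑ k ∈ S, (a k : ℝ≥0∞) ^ q * ν k ≤ _ at h
  simp only [e1, e2] at h
  set X := ∑ k ∈ S, ν k ^ (p / (p - q)) with hX
  have hXtop : X ≠ ∞ := ENNReal.sum_ne_top.2 fun k _ =>
    ENNReal.rpow_ne_top_of_nonneg (by positivity) (hνtop k)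
  rcases eq_or_ne X 0 with h0 | h0
  · rw [h0]; exact zero_le
  have h1 : X ^ (1 - q / p) ≤ C * K ^ q := by
    rw [ENNReal.rpow_sub _ _ h0 hXtop, ENNReal.rpow_one]
    exact ENNReal.div_le_of_le_mul h
  have h2 := ENNReal.rpow_le_rpow h1 (show 0 ≤ p / (p - q) by positivity)
  rw [← ENNReal.rpow_mul] at h2
  have e3 : (1 - q / p) * (p / (p - q)) = 1 := by field_simp
  rwa [e3, ENNReal.rpow_one] at h2

/-- The lower bound: the Berezin type transform is controlled by any bound for `uC_ψ`. -/
theorem exists_eLpNorm_berezin_le (n m : ℕ) {α p q : ℝ} (hn : 1 ≤ n) (hα : 0 < α) (hq : 0 < q)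
    (hqp : q < p) :
    ∃ C : ℝ≥0∞, C ≠ ∞ ∧ ∀ (u : Cn n → ℂ) (ψ : Cn n → Cn n), Continuous u → Continuous ψ →
      ∀ K : ℝ≥0∞, K ≠ ∞ → (∀ f ∈ fsSpace n m α p,
        fsNorm n m α q (wComp u ψ f) ≤ K * fsNorm n m α p f) →
        eLpNorm (berezin n m α q u ψ) (ENNReal.ofReal (p / (p - q))) volume ≤ C * K ^ q := by
  have hp : 0 < p := hq.trans hqp
  have hs : 0 < p / (p - q) := div_pos hp (sub_pos.2 hqp)
  obtain ⟨C, hC, hCs⟩ := exists_tsum_latCell_rpow_le n m hn hα hq hqp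
  have hb : 0 < α * q / 2 := by positivity
  obtain ⟨D, hD, hDs⟩ := exists_lintegral_tsum_gauss_rpow_le n (half_pos hb) hs
  let E := ENNReal.ofReal (Real.exp (α * q / 2 * (2 * n)))
  refine ⟨E * D ^ (1 / (p / (p - q))) * C, ENNReal.mul_ne_top (ENNReal.mul_ne_top
    ENNReal.ofReal_ne_top (ENNReal.rpow_ne_top_of_nonneg (by positivity) hD)) hC,
    fun u ψ hu hψ K hKtop hK => ?_⟩
  let ν : LatIdx n → ℝ≥0∞ := fun k => ∫⁻ z in ψ ⁻¹' latCell k, pullDens m α q u ψ z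
  have hcell : ∀ k, MeasurableSet (ψ ⁻¹' latCell k) := fun k =>
    hψ.measurable (measurableSet_latCell k)
  have hpm := measurable_pullDens m α q hu hψ
  -- When ψ(z) lies in a cell, the Gaussian is recentred at its lattice point at the cost of halving
  -- the exponent.
  have hpt : ∀ w, berezin n m α q u ψ w
      ≤ E * ∑' k, ν k * gauss (α * q / 2 / 2) (w - latPt k) := by
    intro w
    have hU : ⋃ k, ψ ⁻¹' latCell k = Set.univ := by
      rw [← Set.preimage_iUnion, iUnion_latCell, Set.preimage_univ]
    have hdis : Pairwise (Function.onFun Disjoint fun k => ψ ⁻¹' latCell k) := fun k l hkl =>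
      (pairwise_disjoint_latCell hkl).preimage ψ
    rw [berezin_eq, ← setLIntegral_univ, ← hU, lintegral_iUnion hcell hdis, ← ENNReal.tsum_mul_left]
    refine ENNReal.tsum_le_tsum fun k => ?_
    rw [← mul_assoc, mul_right_comm, ← lintegral_const_mul _ hpm]
    refine setLIntegral_mono' (hcell k) fun z hz => mul_le_mul_left ?_ _
    exact gauss_sub_le hb.le (norm_sub_latPt_sq_le hz)
  rw [eLpNorm_ennreal hs]
  have h1 : ∫⁻ w, berezin n m α q u ψ w ^ (p / (p - q))
      ≤ E ^ (p / (p - q)) * (D * (C * K ^ q) ^ (p / (p - q))) := by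
    refine (lintegral_mono fun w => ENNReal.rpow_le_rpow (hpt w) hs.le).trans ?_
    simp_rw [ENNReal.mul_rpow_of_nonneg E _ hs.le]
    rw [lintegral_const_mul' _ _ (ENNReal.rpow_ne_top_of_nonneg hs.le ENNReal.ofReal_ne_top)]
    exact mul_le_mul_right ((hDs ν).trans
      (mul_le_mul_right (hCs u ψ hu hψ K hKtop hK) _)) _
  refine (ENNReal.rpow_le_rpow h1 (by positivity)).trans (le_of_eq ?_)
  have hss : p / (p - q) * (1 / (p / (p - q))) = 1 := mul_one_div_cancel hs.ne'
  rw [ENNReal.mul_rpow_of_nonneg _ _ (by positivity), ENNReal.mul_rpow_of_nonneg _ _ (by positivity),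
    ← ENNReal.rpow_mul, ← ENNReal.rpow_mul, hss, ENNReal.rpow_one, ENNReal.rpow_one]
  ring

/-! ### Operator norm estimates and conclusion. -/

theorem IsBoundedOp.opNorm_ne_top {n m : ℕ} {α p q : ℝ} {u : Cn n → ℂ} {ψ : Cn n → Cn n}
    (h : IsBoundedOp n m α p q u ψ) : opNorm n m α p q u ψ ≠ ∞ := by
  obtain ⟨C, hC⟩ := h.2
  refine ne_top_of_le_ne_top (ENNReal.coe_ne_top (r := C)) (iSup₂_le fun f hf => ?_)
  exact (hC f hf.1).trans (mul_le_of_le_one_right' hf.2)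

theorem IsBoundedOp.fsNorm_wComp_le_opNorm {n m : ℕ} {α p q : ℝ} (hp : 0 < p) (hq : 0 < q)
    {u : Cn n → ℂ} {ψ : Cn n → Cn n} (h : IsBoundedOp n m α p q u ψ) {f : Cn n → ℂ}
    (hf : f ∈ fsSpace n m α p) :
    fsNorm n m α q (wComp u ψ f) ≤ opNorm n m α p q u ψ * fsNorm n m α p f := by
  obtain ⟨C, hC⟩ := h.2
  -- A function of norm zero cannot be normalized, but boundedness forces its image to have norm
  -- zero.
  rcases eq_or_ne (fsNorm n m α p f) 0 with h0 | h0
  · have := hC f hf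
    rw [h0, mul_zero] at this ⊢
    exact this
  have htop : fsNorm n m α p f ≠ ∞ := hf.2.ne
  have hr : 0 < (fsNorm n m α p f).toReal := ENNReal.toReal_pos h0 htop
  let t : ℂ := (((fsNorm n m α p f).toReal⁻¹ : ℝ) : ℂ)
  have ht : ENNReal.ofReal ‖t‖ = (fsNorm n m α p f)⁻¹ := by
    rw [Complex.norm_real, Real.norm_of_nonneg (inv_pos.2 hr).le, ENNReal.ofReal_inv_of_pos hr,
      ENNReal.ofReal_toReal htop]
  have h1 : fsNorm n m α p (fun z => t * f z) = 1 := by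
    rw [fsNorm_const_mul m α hp, ht, ENNReal.inv_mul_cancel h0 htop]
  have hmem : (fun z => t * f z) ∈ {f | f ∈ fsSpace n m α p ∧ fsNorm n m α p f ≤ 1} :=
    ⟨⟨hf.1.const_mul t, by rw [h1]; exact ENNReal.one_lt_top⟩, h1.le⟩
  have h2 : fsNorm n m α q (wComp u ψ fun z => t * f z) ≤ opNorm n m α p q u ψ :=
    le_iSup₂ (f := fun f (_ : f ∈ {f | f ∈ fsSpace n m α p ∧ fsNorm n m α p f ≤ 1}) =>
      fsNorm n m α q (wComp u ψ f)) _ hmem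
  have e : (wComp u ψ fun z => t * f z) = fun z => t * wComp u ψ f z := by
    funext z
    simp only [wComp]; ring
  rw [e, fsNorm_const_mul m α hq, ht, ← ENNReal.div_eq_inv_mul] at h2
  rwa [ENNReal.div_le_iff h0 htop] at h2

theorem exists_bounds_opNorm {n : ℕ} (m : ℕ) (hn : 1 ≤ n) {α p q : ℝ} (hα : 0 < α) (hq : 0 < q)
    (hqp : q < p) :
    ∃ c C : ℝ≥0, 0 < c ∧ 0 < C ∧ ∀ (u : Cn n → ℂ) (ψ : Cn n → Cn n), Differentiable ℂ u →
      Differentiable ℂ ψ → IsBoundedOp n m α p q u ψ →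
      c * eLpNorm (berezin n m α q u ψ) (ENNReal.ofReal (p / (p - q))) volume ^ (1 / q)
          ≤ opNorm n m α p q u ψ ∧
        opNorm n m α p q u ψ ≤
          C * eLpNorm (berezin n m α q u ψ) (ENNReal.ofReal (p / (p - q))) volume ^ (1 / q) := by
  have hp : 0 < p := hq.trans hqp
  obtain ⟨A, hA, hAle⟩ := exists_fsNorm_wComp_le_eLpNorm n m hn hα hq hqp
  obtain ⟨D, hD, hDle⟩ := exists_eLpNorm_berezin_le n m hn hα hq hqp
  -- Adding 1 makes the constant positive without knowing that `D` is nonzero.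
  let d : ℝ≥0 := (D.toNNReal + 1) ^ (1 / q)
  have hd : 0 < d := NNReal.rpow_pos (by positivity)
  refine ⟨d⁻¹, A.toNNReal + 1, inv_pos.2 hd, by positivity, fun u ψ hu hψ hb => ⟨?_, ?_⟩⟩
  · have h := hDle u ψ hu.continuous hψ.continuous _ hb.opNorm_ne_top
      fun f hf => hb.fsNorm_wComp_le_opNorm hp hq hf
    have h1 : eLpNorm (berezin n m α q u ψ) (ENNReal.ofReal (p / (p - q))) volume ^ (1 / q)
        ≤ d * opNorm n m α p q u ψ := by
      refine (ENNReal.rpow_le_rpow h (by positivity)).trans ?_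
      rw [ENNReal.mul_rpow_of_nonneg _ _ (by positivity), ← ENNReal.rpow_mul,
        mul_one_div_cancel hq.ne', ENNReal.rpow_one]
      refine mul_le_mul_left ?_ _
      rw [ENNReal.coe_rpow_of_nonneg _ (by positivity)]
      refine ENNReal.rpow_le_rpow ?_ (by positivity)
      rw [ENNReal.coe_add, ENNReal.coe_toNNReal hD]
      exact le_self_add
    rw [ENNReal.coe_inv hd.ne', ← ENNReal.div_eq_inv_mul]
    exact ENNReal.div_le_of_le_mul' h1
  · refine iSup₂_le fun f hf => ?_
    refine (hAle u ψ hu.continuous hψ.continuous f hf.1.1).trans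
      ((mul_le_of_le_one_right' hf.2).trans (mul_le_mul_left ?_ _))
    rw [ENNReal.coe_add, ENNReal.coe_toNNReal hA]
    exact le_self_add

theorem IsBoundedOp.memLp_berezin {n m : ℕ} (hn : 1 ≤ n) {α p q : ℝ} (hα : 0 < α) (hq : 0 < q)
    (hqp : q < p) {u : Cn n → ℂ} {ψ : Cn n → Cn n} (hu : Differentiable ℂ u)
    (hψ : Differentiable ℂ ψ) (h : IsBoundedOp n m α p q u ψ) :
    MemLp (berezin n m α q u ψ) (ENNReal.ofReal (p / (p - q))) volume := by
  obtain ⟨D, hD, hDle⟩ := exists_eLpNorm_berezin_le n m hn hα hq hqp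
  obtain ⟨C, hC⟩ := h.2
  refine ⟨(measurable_berezin m α q hu.continuous hψ.continuous).aestronglyMeasurable, ?_⟩
  refine (hDle u ψ hu.continuous hψ.continuous C ENNReal.coe_ne_top hC).trans_lt ?_
  exact ENNReal.mul_lt_top hD.lt_top (ENNReal.rpow_lt_top_of_nonneg hq.le ENNReal.coe_ne_top)

end FockSobolev

end

theorem mainTheorem6 (n m : ℕ) (hn : 1 ≤ n) (α p q : ℝ) (hα : 0 < α) (hq : 0 < q)
    (hqp : q < p) :
    (∀ (u : FockSobolev.Cn n → ℂ) (ψ : FockSobolev.Cn n → FockSobolev.Cn n),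
      Differentiable ℂ u → Differentiable ℂ ψ →
      List.TFAE [
        FockSobolev.IsBoundedOp n m α p q u ψ,
        FockSobolev.IsCompactOp n m α p q u ψ,
        MemLp (FockSobolev.berezin n m α q u ψ) (ENNReal.ofReal (p / (p - q))) volume]) ∧
    ∃ c C : ℝ≥0, 0 < c ∧ 0 < C ∧
      ∀ (u : FockSobolev.Cn n → ℂ) (ψ : FockSobolev.Cn n → FockSobolev.Cn n),
        Differentiable ℂ u → Differentiable ℂ ψ →
        FockSobolev.IsBoundedOp n m α p q u ψ →
        c * eLpNorm (FockSobolev.berezin n m α q u ψ)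
            (ENNReal.ofReal (p / (p - q))) volume ^ (1 / q)
          ≤ FockSobolev.opNorm n m α p q u ψ ∧
        FockSobolev.opNorm n m α p q u ψ ≤
          C * eLpNorm (FockSobolev.berezin n m α q u ψ)
            (ENNReal.ofReal (p / (p - q))) volume ^ (1 / q) := by
  refine ⟨fun u ψ hu hψ => ?_, FockSobolev.exists_bounds_opNorm m hn hα hq hqp⟩
  tfae_have 1 → 3 := fun h => h.memLp_berezin hn hα hq hqp hu hψ
  tfae_have 3 → 2 := FockSobolev.isCompactOp_of_memLp m hn hα hq hqp hu hψ
  tfae_have 2 → 1 := fun h => h.isBoundedOp (hq.trans hqp) hq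
  tfae_finish
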